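/- Let $(S,m)$ be a compact metric space and let $(\Omega,\mathcal F,(\mathcal F_t)_{t\ge0},(\mathbb P_x)_{x\in S})$ be a measurable space with a right-continuous filtration and a measurable family of probability measures. Let $(V_t)_{t\ge0}$ be an $(\mathcal F_t)$-adapted $S$-valued Feller process with c\`adl\`ag paths, i.e. $\mathbb P_x(V_0=x)=1$ for all $x\in S$, the time-homogeneous Markov property with respect to $(\mathcal F_t)$ holds under every $\mathbb P_x$, and $x\mapsto\mathbb E_x[h(V_t)]$ is continuous for every $t\ge 0$ and every continuous $h:S\to\mathbb R$. For a probability measure $\mu$ on $S$ put $\mathbb P_\mu=\int_S\mathbb P_y\,\mu(\mathrm dy)$. Assume: (i) $(V_t)$ has a unique invariant probability measure $\pi$. (ii) For every $x\in S$ there are c\`adl\`ag processes $(V^x_t)_{t\ge 0}$ and $(V^\pi_t)_{t\ge 0}$, defined on a common probability space $(\tilde\Omega,\tilde{\mathcal F},\tilde{\mathbb P})$, whose finite-dimensional distributions are those of $(V_t)$ under $\mathbb P_x$ and under $\mathbb P_\pi$, respectively. (iii) $T^x=\inf\{t\ge0: V^x_t=V^\pi_t\}$ is a stopping time (for some filtration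 to which both processes are adapted), and there are constants $C,\delta>0$ with $\sup_{x\in S}\tilde{\mathbb P}(T^x\ge t)\le Ce^{-\delta t}$ for all $t\ge0$. Let $f:\mathbb R^K\times S\to\mathbb R$ be continuous and twice continuously differentiable in $\theta\in\mathbb R^K$, such that $\nabla_\theta f$ and the Hessian $H_\theta f$ are continuous on $\mathbb R^K\times S$, $\nabla_\theta f(\cdot,y)$ is Lipschitz with a constant independent of $y\in S$, and $f(\theta,\cdot)$ and $\nabla_\theta f(\theta,\cdot)$ are $\pi$-integrable for every $\theta$. Let $\theta_0\in\mathbb R^K$. For $\varepsilon>0$ let $(\theta^\varepsilon_t)_{t\ge0}$ be the process with continuous paths that solves, $\mathbb P_\pi$-almost surely, $$\mathrm d\theta^\varepsilon_t=-\nabla_\theta f(\theta^\varepsilon_t,V_{t/\varepsilon})\,\mathrm dt,\qquad \theta^\varepsilon_0=\theta_0,$$ and let $(\zeta_t)_{t\ge0}$ solve the full gradient flow $$\mathrm d\zeta_t=-\Big[\int_S\nabla_\theta f(\zeta_t,v)\,\pi(\mathrm dv)\Big]\mathrm dt,\qquad \zeta_0=\theta_0.$$ Then, as $\varepsilon\to0$,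 $(\theta^\varepsilon_t)_{t\ge0}$ under $\mathbb P_\pi$ converges weakly to $(\zeta_t)_{t\ge0}$ in the space $\mathcal C([0,\infty);\mathbb R^K)$ of continuous functions equipped with the distance $$\rho(\varphi,\varphi')=\int_0^\infty e^{-t}\Big(1\wedge\sup_{0\le s\le t}\|\varphi_s-\varphi'_s\|\Big)\mathrm dt;$$ that is, for every bounded continuous $F:\mathcal C([0,\infty);\mathbb R^K)\to\mathbb R$, the random variable $F((\theta^\varepsilon_t)_{t\ge0})$ is $\mathbb P_\pi$-integrable for every $\varepsilon>0$ and $$\mathbb E_\pi\big[F\big((\theta^\varepsilon_t)_{t\ge0}\big)\big]\longrightarrow\mathbb E_\pi\big[F\big((\zeta_t)_{t\ge0}\big)\big]=F\big((\zeta_t)_{t\ge0}\big)\qquad(\varepsilon\to0).$$ -/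

import Mathlib

open MeasureTheory ProbabilityTheory Filter Topology
open scoped NNReal ENNReal

universe u v w

noncomputable section

namespace SGP

/-- A path `[0,∞) → S` that is right continuous with left limits. -/
def IsCadlag {S : Type u} [TopologicalSpace S] (p : ℝ≥0 → S) : Prop :=
  (∀ t, ContinuousWithinAt p (Set.Ici t) t) ∧ ∀ t, ∃ l, Tendsto p (𝓝[<] t) (𝓝 l)

/-- `(V_t)` is a càdlàg Feller process on the compact space `S`, with respect to the right
continuous filtration `𝓕` and the family of laws `(P x)`, where `P x` makes the process start at
`x`. (Strong continuity of the semigroup at time `0` follows from right continuity of the paths.) -/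
structure IsFellerProcess {S : Type u} [TopologicalSpace S] [MeasurableSpace S]
    {Ω : Type v} {mΩ : MeasurableSpace Ω} (𝓕 : Filtration ℝ≥0 mΩ)
    (V : ℝ≥0 → Ω → S) (P : Kernel S Ω) : Prop where
  rightCont : 𝓕.IsRightContinuous
  adapted : Adapted 𝓕 V
  cadlag : ∀ ω, IsCadlag fun t => V t ω
  prob : ∀ x, IsProbabilityMeasure (P x)
  start : ∀ x, ∀ᵐ ω ∂(P x), V 0 ω = x
  /-- The time-homogeneous Markov property. -/
  markov : ∀ (x : S) (s t : ℝ≥0) (h : S → ℝ), Measurable h → (∃ M, ∀ y, |h y| ≤ M) →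
    (P x)[fun ω => h (V (s + t) ω) | 𝓕 s] =ᵐ[P x] fun ω => ∫ ω', h (V t ω') ∂(P (V s ω))
  /-- The transition semigroup maps continuous functions to continuous functions. -/
  feller : ∀ (t : ℝ≥0) (h : S → ℝ), Continuous h → Continuous fun x => ∫ ω, h (V t ω) ∂(P x)

/-- The probability measure `π` on `S` is invariant for the process: if `V_0 ∼ π` then
`V_t ∼ π` for all `t`, i.e. `∫ P_x(V_t ∈ A) π(dx) = π(A)`. -/
def IsInvariantLaw {S : Type u} [MeasurableSpace S] {Ω : Type v} [MeasurableSpace Ω]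
    (V : ℝ≥0 → Ω → S) (P : Kernel S Ω) (π : Measure S) : Prop :=
  IsProbabilityMeasure π ∧ ∀ t, Kernel.Invariant (P.map (V t)) π

/-- The processes `X` under `μ` and `Y` under `ν` have the same finite-dimensional distributions. -/
def SameFDD {S : Type u} [MeasurableSpace S] {Ω : Type v} [MeasurableSpace Ω]
    {Ω' : Type w} [MeasurableSpace Ω'] (X : ℝ≥0 → Ω → S) (μ : Measure Ω)
    (Y : ℝ≥0 → Ω' → S) (ν : Measure Ω') : Prop :=
  ∀ (n : ℕ) (t : Fin n → ℝ≥0) (A : Fin n → Set S), StrictMono t → (∀ i, MeasurableSet (A i)) →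
    μ {ω | ∀ i, X (t i) ω ∈ A i} = ν {ω | ∀ i, Y (t i) ω ∈ A i}

/-- The first meeting time `inf {t ≥ 0 | X_t = Y_t}`, equal to `⊤` if the two never meet. -/
def meetingTime {S : Type u} {Ω : Type v} (X Y : ℝ≥0 → Ω → S) : Ω → WithTop ℝ≥0 :=
  hittingAfter (fun t ω => (X t ω, Y t ω)) (Set.diagonal S) 0

/-- Assumptions on the index process: it has the unique invariant probability measure `π`, and for
every `x` the process started at `x` can be coupled, on some probability space, with a stationary
version such that the first meeting time has exponential tails, uniformly in `x`.
The law of `V` started from `π` is `π.bind P = ∫ P_y(·) π(dy)`. -/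
structure IndexAssumption {S : Type u} [TopologicalSpace S] [MeasurableSpace S]
    {Ω : Type v} [MeasurableSpace Ω]
    (V : ℝ≥0 → Ω → S) (P : Kernel S Ω) (π : Measure S) : Prop where
  invariant : IsInvariantLaw V P π
  unique : ∀ μ : Measure S, IsInvariantLaw V P μ → μ = π
  coupling : ∃ C δ : ℝ, 0 < C ∧ 0 < δ ∧ ∀ x : S,
    ∃ (Ω' : Type w) (m' : MeasurableSpace Ω') (Q : Measure Ω') (Vx Vπ : ℝ≥0 → Ω' → S)
      (𝓖 : Filtration ℝ≥0 m'),
      IsProbabilityMeasure Q ∧ Adapted 𝓖 Vx ∧ Adapted 𝓖 Vπ ∧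
      (∀ ω, IsCadlag fun t => Vx t ω) ∧ (∀ ω, IsCadlag fun t => Vπ t ω) ∧
      SameFDD Vx Q V (P x) ∧ SameFDD Vπ Q V (π.bind P) ∧
      IsStoppingTime 𝓖 (meetingTime Vx Vπ) ∧
      ∀ t : ℝ≥0, Q {ω | (t : WithTop ℝ≥0) ≤ meetingTime Vx Vπ ω} ≤
        ENNReal.ofReal (C * Real.exp (-δ * t))

/-- Assumptions on the subsampled target function `f : ℝ^K × S → ℝ`: it is continuous, twice
continuously differentiable in `θ` with gradient and Hessian in `θ` jointly continuous, the gradient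
is Lipschitz in `θ` uniformly in `y`, and `f(θ,·)`, `∇_θ f(θ,·)` are `π`-integrable. -/
structure TargetAssumption {K : ℕ} {S : Type u} [TopologicalSpace S] [MeasurableSpace S]
    (f : EuclideanSpace ℝ (Fin K) → S → ℝ) (π : Measure S) : Prop where
  cont : Continuous fun p : EuclideanSpace ℝ (Fin K) × S => f p.1 p.2
  contDiff : ∀ y, ContDiff ℝ 2 fun θ => f θ y
  cont_grad : Continuous fun p : EuclideanSpace ℝ (Fin K) × S => gradient (fun θ => f θ p.2) p.1
  cont_hess : Continuous fun p : EuclideanSpace ℝ (Fin K) × S =>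
    fderiv ℝ (gradient fun θ => f θ p.2) p.1
  lipschitz : ∃ L : ℝ≥0, ∀ y, LipschitzWith L (gradient fun θ => f θ y)
  integrable : ∀ θ, Integrable (f θ) π
  integrable_grad : ∀ θ, Integrable (fun y => gradient (fun x => f x y) θ) π

/-- The path `θ` solves `dθ_t = -∇_θ f(θ_t, p_{t/ε}) dt` with initial value `θ₀`, where `p` is the
path of the index process. -/
def SolvesSGPC {K : ℕ} {S : Type u} (f : EuclideanSpace ℝ (Fin K) → S → ℝ) (ε : ℝ)
    (θ₀ : EuclideanSpace ℝ (Fin K)) (p : ℝ≥0 → S) (θ : C(ℝ≥0, EuclideanSpace ℝ (Fin K))) : Prop :=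
  ∀ t : ℝ≥0, θ t =
    θ₀ - ∫ s in (0 : ℝ)..t, gradient (fun x => f x (p (s / ε).toNNReal)) (θ s.toNNReal)

/-- The path `ζ` solves the full gradient flow `dζ_t = -(∫ ∇f(ζ_t, v) π(dv)) dt` with initial
value `θ₀`. -/
def SolvesFullFlow {K : ℕ} {S : Type u} [MeasurableSpace S]
    (f : EuclideanSpace ℝ (Fin K) → S → ℝ) (π : Measure S)
    (θ₀ : EuclideanSpace ℝ (Fin K)) (ζ : C(ℝ≥0, EuclideanSpace ℝ (Fin K))) : Prop :=
  ∀ t : ℝ≥0, ζ t =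
    θ₀ - ∫ s in (0 : ℝ)..t, ∫ v, gradient (fun x => f x v) (ζ s.toNNReal) ∂π

/-- The distance `ρ(φ,ψ) = ∫_0^∞ e^{-t} (1 ∧ sup_{0 ≤ s ≤ t} ‖φ_s - ψ_s‖) dt` on `C([0,∞); ℝ^K)`. -/
def pathDist {K : ℕ} (φ ψ : C(ℝ≥0, EuclideanSpace ℝ (Fin K))) : ℝ :=
  ∫ t in Set.Ioi (0 : ℝ),
    Real.exp (-t) * min 1 (⨆ s : Set.Icc (0 : ℝ≥0) t.toNNReal, ‖φ s - ψ s‖)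

/-- Continuity of a functional on path space with respect to the distance `pathDist`. -/
def PathContinuous {K : ℕ} (F : C(ℝ≥0, EuclideanSpace ℝ (Fin K)) → ℝ) : Prop :=
  ∀ φ, ∀ η > 0, ∃ δ > 0, ∀ ψ, pathDist φ ψ < δ → |F φ - F ψ| < η

end SGP

end

/-!
Only stationarity and unique ergodicity of the index process enter. By the Krylov–Bogoliubov
argument every weak limit point of the occupation measures `T⁻¹ ∫_0^T P_x(V_t ∈ ·) dt` is an
invariant law, hence equal to `π`. The correlations `E_π[h(V_0) h(V_t)]` therefore average to
`(∫ h dπ)²`, so the variance of the time averages of `h` tends to zero and these averages converge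
in measure. Freezing `ζ` on a fine grid, the fluctuations of the rescaled vector field integrate to
a small path along `ζ`, and Grönwall's inequality transports this smallness to `θ^ε - ζ`.

Convergence in measure is convergence along a filter on `ℝ × Ω`, which is how a deterministic
averaging principle along an arbitrary filter applies to the random trajectories.
-/

namespace SGP

section InMeasure

variable {ι : Type*} {Ω : Type*} [MeasurableSpace Ω] {l : Filter ι} {ρ : Measure Ω}

/-- The filter of convergence in measure: a set belongs to it if the measure of its complementary
sections tends to zero. Convergence of `fun p => X p.1 p.2` to `a` along this filter says that the
family `X i` converges to the constant `a` in measure along `l`. -/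
def inMeasure (l : Filter ι) (ρ : Measure Ω) : Filter (ι × Ω) :=
  Filter.comk (fun s => Tendsto (fun i => ρ (Prod.mk i ⁻¹' s)) l (𝓝 0))
    (by simpa using tendsto_const_nhds)
    (fun _ ht _ hst => tendsto_of_tendsto_of_tendsto_of_le_of_le tendsto_const_nhds ht
      (fun _ => zero_le) fun _ => measure_mono (Set.preimage_mono hst))
    fun _ hs _ ht => by
      have hadd := Tendsto.add hs ht
      rw [add_zero] at hadd
      exact tendsto_of_tendsto_of_tendsto_of_le_of_le tendsto_const_nhds hadd
        (fun _ => zero_le) fun _ => measure_union_le _ _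

theorem eventually_inMeasure {p : ι × Ω → Prop} :
    (∀ᶠ q in inMeasure l ρ, p q) ↔ Tendsto (fun i => ρ {ω | ¬p (i, ω)}) l (𝓝 0) :=
  Filter.mem_comk

theorem eventually_inMeasure_of_ae {p : ι × Ω → Prop} (h : ∀ᶠ i in l, ∀ᵐ ω ∂ρ, p (i, ω)) :
    ∀ᶠ q in inMeasure l ρ, p q :=
  eventually_inMeasure.2 (tendsto_const_nhds.congr' (h.mono fun _ hi => (ae_iff.1 hi).symm))

theorem tendsto_map_id_inMeasure {ι' : Type*} {l' : Filter ι'} {m : ι → ι'} (hm : Tendsto m l l') :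
    Tendsto (Prod.map m id) (inMeasure l ρ) (inMeasure l' ρ) := fun s hs =>
  eventually_inMeasure.2 ((eventually_inMeasure (p := fun q => q ∈ s).1 hs).comp hm)

theorem tendsto_inMeasure_of_variance [IsFiniteMeasure ρ] {X : ι → Ω → ℝ} {m : ℝ}
    (hX : ∀ᶠ i in l, MemLp (X i) 2 ρ) (hm : ∀ᶠ i in l, ∫ ω, X i ω ∂ρ = m)
    (hvar : Tendsto (fun i => variance (X i) ρ) l (𝓝 0)) :
    Tendsto (fun p : ι × Ω => X p.1 p.2) (inMeasure l ρ) (𝓝 m) := by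
  refine Metric.tendsto_nhds.2 fun ε hε => eventually_inMeasure.2 ?_
  have hbound : Tendsto (fun i => ENNReal.ofReal (variance (X i) ρ / ε ^ 2)) l (𝓝 0) := by
    simpa using ENNReal.tendsto_ofReal (hvar.div_const (ε ^ 2))
  refine tendsto_of_tendsto_of_tendsto_of_le_of_le' tendsto_const_nhds hbound
    (Eventually.of_forall fun _ => zero_le) ?_
  filter_upwards [hX, hm] with i hXi hmi
  simpa only [hmi, not_lt, Real.dist_eq] using meas_ge_le_variance_div_sq hXi hε

theorem tendsto_integral_of_tendsto_inMeasure [IsProbabilityMeasure ρ] {X : ι → Ω → ℝ} {a M : ℝ}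
    (hX : ∀ᶠ i in l, AEStronglyMeasurable (X i) ρ) (hM : ∀ i ω, |X i ω| ≤ M)
    (h : Tendsto (fun p : ι × Ω => X p.1 p.2) (inMeasure l ρ) (𝓝 a)) :
    Tendsto (fun i => ∫ ω, X i ω ∂ρ) l (𝓝 a) := by
  have hlim : Tendsto (fun p : ι × Ω => |X p.1 p.2 - a|) (inMeasure l ρ) (𝓝 0) := by
    simpa using (h.sub_const a).abs
  refine Metric.tendsto_nhds.2 fun ε hε => ?_
  have hrare := eventually_inMeasure.1 (hlim.eventually_lt_const (half_pos hε))
  have hreal : Tendsto (fun i => (M + |a|) * ρ.real {ω | ¬|X i ω - a| < ε / 2}) l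
      (𝓝 ((M + |a|) * 0)) :=
    ((ENNReal.tendsto_toReal ENNReal.zero_ne_top).comp hrare).const_mul _
  rw [mul_zero] at hreal
  filter_upwards [hX, hreal.eventually_lt_const (half_pos hε)] with i hXi hi
  set A := {ω | ¬|X i ω - a| < ε / 2}
  have hA : NullMeasurableSet A ρ :=
    (nullMeasurableSet_lt (hXi.sub aestronglyMeasurable_const).norm.aemeasurable
      aemeasurable_const).compl
  have hint : Integrable (X i) ρ := .of_bound hXi M (Eventually.of_forall (hM i))
  have hindicator : Integrable (A.indicator fun _ => M + |a|) ρ :=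
    (integrable_const _).indicator₀ hA
  have hpointwise : ∀ ω, |X i ω - a| ≤ ε / 2 + A.indicator (fun _ => M + |a|) ω := fun ω => by
    by_cases hω : ω ∈ A
    · rw [Set.indicator_of_mem hω]
      linarith [abs_sub (X i ω) a, hM i ω]
    · rw [Set.indicator_of_notMem hω, add_zero]
      exact (not_not.1 hω).le
  calc dist (∫ ω, X i ω ∂ρ) a = |∫ ω, (X i ω - a) ∂ρ| := by
        rw [integral_sub hint (integrable_const a), integral_const, probReal_univ, one_smul,
          Real.dist_eq]
    _ ≤ ∫ ω, |X i ω - a| ∂ρ := abs_integral_le_integral_abs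
    _ ≤ ∫ ω, (ε / 2 + A.indicator (fun _ => M + |a|) ω) ∂ρ :=
        integral_mono (hint.sub (integrable_const a)).abs
          ((integrable_const _).add hindicator) hpointwise
    _ = ε / 2 + (M + |a|) * ρ.real A := by
        rw [integral_add (integrable_const _) hindicator, integral_indicator₀ hA]
        simp [mul_comm]
    _ < ε := by linarith

end InMeasure

section ParametrizedIntegral

variable {Ω : Type*} [MeasurableSpace Ω] {E : Type*} [NormedAddCommGroup E]

theorem intervalIntegrable_of_bound {m : ℝ → E} (hm : AEStronglyMeasurable m) {M : ℝ}
    (hM : ∀ s, ‖m s‖ ≤ M) (a b : ℝ) : IntervalIntegrable m volume a b :=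
  intervalIntegrable_iff.2 <|
    Measure.integrableOn_of_bounded (by simp) hm (Eventually.of_forall hM)

theorem norm_integral_le_of_bound {ρ : Measure Ω} [IsProbabilityMeasure ρ] [NormedSpace ℝ E]
    {X : Ω → E} {M : ℝ} (hM : ∀ ω, ‖X ω‖ ≤ M) : ‖∫ ω, X ω ∂ρ‖ ≤ M := by
  simpa using norm_integral_le_of_norm_le_const (μ := ρ) (Eventually.of_forall hM)

variable [NormedSpace ℝ E]

theorem stronglyMeasurable_intervalIntegral {X : ℝ → Ω → E}
    (hX : StronglyMeasurable fun p : ℝ × Ω => X p.1 p.2) (a b : ℝ) :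
    StronglyMeasurable fun ω => ∫ s in a..b, X s ω := by
  simp only [intervalIntegral]
  exact hX.integral_prod_left'.sub hX.integral_prod_left'

theorem integral_intervalIntegral_swap {ρ : Measure Ω} [IsFiniteMeasure ρ] {X : ℝ → Ω → E}
    (hX : StronglyMeasurable fun p : ℝ × Ω => X p.1 p.2) {M : ℝ} (hM : ∀ s ω, ‖X s ω‖ ≤ M)
    (a b : ℝ) : ∫ ω, (∫ s in a..b, X s ω) ∂ρ = ∫ s in a..b, ∫ ω, X s ω ∂ρ := by
  refine (intervalIntegral_integral_swap ?_).symm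
  have : IsFiniteMeasure (volume.restrict (Set.uIoc a b)) := ⟨by simp⟩
  exact Integrable.of_bound hX.aestronglyMeasurable M (Eventually.of_forall fun p => hM _ _)

theorem integral_sq_intervalIntegral {ρ : Measure Ω} [IsFiniteMeasure ρ] {X : ℝ → Ω → ℝ}
    (hX : StronglyMeasurable fun p : ℝ × Ω => X p.1 p.2) {M : ℝ} (hM : ∀ s ω, |X s ω| ≤ M)
    (a b : ℝ) :
    ∫ ω, (∫ s in a..b, X s ω) ^ 2 ∂ρ =
      ∫ s in a..b, ∫ r in a..b, ∫ ω, X s ω * X r ω ∂ρ := by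
  have hsection : ∀ s, StronglyMeasurable fun p : ℝ × Ω => X s p.2 := fun s =>
    hX.comp_measurable (measurable_const.prodMk measurable_snd)
  have hprod : ∀ s r ω, ‖X s ω * X r ω‖ ≤ M * M := fun s r ω => by
    rw [norm_mul]
    exact mul_le_mul (hM s ω) (hM r ω) (norm_nonneg _) ((abs_nonneg _).trans (hM s ω))
  have hint : ∀ s ω, ‖X s ω * ∫ r in a..b, X r ω‖ ≤ M * M * |b - a| := fun s ω => by
    rw [← intervalIntegral.integral_const_mul]
    exact intervalIntegral.norm_integral_le_of_norm_le_const fun r _ => hprod s r ω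
  simp only [sq, ← intervalIntegral.integral_mul_const]
  rw [integral_intervalIntegral_swap (X := fun s ω => X s ω * ∫ r in a..b, X r ω)
    (hX.mul ((stronglyMeasurable_intervalIntegral hX a b).comp_measurable measurable_snd)) hint]
  simp only [← intervalIntegral.integral_const_mul]
  exact intervalIntegral.integral_congr fun s _ =>
    integral_intervalIntegral_swap ((hsection s).mul hX) (hprod s) a b

theorem tendsto_average_shift_sub_average {m : ℝ → E} (hm : AEStronglyMeasurable m) {M : ℝ}
    (hM : ∀ s, ‖m s‖ ≤ M) (t : ℝ) :
    Tendsto (fun T : ℝ => (∫ r in (0 : ℝ)..1, m (T * r + t)) - ∫ r in (0 : ℝ)..1, m (T * r))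
      atTop (𝓝 0) := by
  have hint := intervalIntegrable_of_bound hm hM
  have hbound : ∀ a b : ℝ, ‖∫ r in a..b, m r‖ ≤ M * |b - a| := fun a b =>
    intervalIntegral.norm_integral_le_of_norm_le_const fun s _ => hM s
  have hlim : Tendsto (fun T : ℝ => T⁻¹ * (M * |t| + M * |t|)) atTop (𝓝 0) := by
    simpa using tendsto_inv_atTop_zero.mul_const (M * |t| + M * |t|)
  refine squeeze_zero_norm' ?_ hlim
  filter_upwards [eventually_gt_atTop 0] with T hT
  have hsub : (∫ r in t..(T + t), m r) - ∫ r in (0 : ℝ)..T, m r =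
      (∫ r in T..(T + t), m r) - ∫ r in (0 : ℝ)..t, m r := by
    rw [← intervalIntegral.integral_interval_sub_left (hint 0 (T + t)) (hint 0 t),
      ← intervalIntegral.integral_interval_sub_left (hint 0 (T + t)) (hint 0 T)]
    abel
  rw [intervalIntegral.integral_comp_mul_add _ hT.ne',
    intervalIntegral.integral_comp_mul_left _ hT.ne', ← smul_sub]
  simp only [mul_zero, zero_add, mul_one]
  rw [hsub, norm_smul, Real.norm_of_nonneg (inv_nonneg.2 hT.le)]
  gcongr
  refine (norm_sub_le _ _).trans (add_le_add ?_ ?_)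
  · simpa using hbound T (T + t)
  · simpa using hbound 0 t

end ParametrizedIntegral

section JointMeasurability

theorem tendsto_floor_mul_add_one_div_nhdsGE (t : ℝ≥0) :
    Tendsto (fun n : ℕ => ((⌊((n : ℝ≥0) + 1) * t⌋₊ : ℝ≥0) + 1) / ((n : ℝ≥0) + 1)) atTop
      (𝓝[≥] t) := by
  have hle : ∀ n : ℕ, t ≤ ((⌊((n : ℝ≥0) + 1) * t⌋₊ : ℝ≥0) + 1) / ((n : ℝ≥0) + 1) := fun n => by
    rw [le_div_iff₀ (by positivity), mul_comm]
    exact (Nat.lt_floor_add_one _).le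
  have hge : ∀ n : ℕ, ((⌊((n : ℝ≥0) + 1) * t⌋₊ : ℝ≥0) + 1) / ((n : ℝ≥0) + 1) ≤
      t + 1 / ((n : ℝ≥0) + 1) := fun n => by
    calc _ ≤ (((n : ℝ≥0) + 1) * t + 1) / ((n : ℝ≥0) + 1) := by
          gcongr
          exact Nat.floor_le zero_le
      _ = _ := by field_simp
  have hlim : Tendsto (fun n : ℕ => t + 1 / ((n : ℝ≥0) + 1)) atTop (𝓝 t) := by
    simpa using tendsto_const_nhds.add (tendsto_one_div_add_atTop_nhds_zero_nat (𝕜 := ℝ≥0))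
  exact tendsto_nhdsWithin_iff.2 ⟨tendsto_of_tendsto_of_tendsto_of_le_of_le tendsto_const_nhds
    hlim hle hge, Eventually.of_forall hle⟩

theorem measurable_uncurry_of_rightContinuous {S : Type*} [TopologicalSpace S]
    [TopologicalSpace.PseudoMetrizableSpace S] [MeasurableSpace S] [BorelSpace S]
    {Ω : Type*} [MeasurableSpace Ω] {V : ℝ≥0 → Ω → S} (hm : ∀ t, Measurable (V t))
    (hc : ∀ ω t, ContinuousWithinAt (fun t => V t ω) (Set.Ici t) t) :
    Measurable (fun p : ℝ≥0 × Ω => V p.1 p.2) := by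
  refine measurable_of_tendsto_metrizable (f := fun n (p : ℝ≥0 × Ω) =>
    V (((⌊((n : ℝ≥0) + 1) * p.1⌋₊ : ℝ≥0) + 1) / ((n : ℝ≥0) + 1)) p.2) (fun n => ?_) ?_
  · have hgrid : Measurable fun q : ℕ × Ω => V (((q.1 : ℝ≥0) + 1) / ((n : ℝ≥0) + 1)) q.2 :=
      measurable_from_prod_countable_right fun k => hm (((k : ℝ≥0) + 1) / ((n : ℝ≥0) + 1))
    exact hgrid.comp (f := fun p : ℝ≥0 × Ω => (⌊((n : ℝ≥0) + 1) * p.1⌋₊, p.2))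
      ((Nat.measurable_floor.comp (measurable_fst.const_mul _)).prodMk measurable_snd)
  · exact tendsto_pi_nhds.2 fun p =>
      (hc p.2 p.1).tendsto.comp (tendsto_floor_mul_add_one_div_nhdsGE p.1)

end JointMeasurability

section Semigroup

variable {S : Type*} [MeasurableSpace S] {Ω : Type*} {mΩ : MeasurableSpace Ω}
  {𝓕 : Filtration ℝ≥0 mΩ} {V : ℝ≥0 → Ω → S} {P : Kernel S Ω} {π : Measure S}

/-- The transition semigroup `P_t φ (x) = E_x[φ(V_t)]` of the process `V` under the laws `P`. -/
noncomputable def semigroup (V : ℝ≥0 → Ω → S) (P : Kernel S Ω) (t : ℝ≥0) (φ : S → ℝ) (x : S) : ℝ :=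
  ∫ ω, φ (V t ω) ∂(P x)

theorem abs_semigroup_le [IsMarkovKernel P] {φ : S → ℝ} {M : ℝ} (hM : ∀ y, |φ y| ≤ M) (t : ℝ≥0)
    (x : S) : |semigroup V P t φ x| ≤ M :=
  norm_integral_le_of_bound (ρ := P x) (X := fun ω => φ (V t ω)) fun _ => hM _

theorem integral_bind_kernel {α β E : Type*} [MeasurableSpace α] [MeasurableSpace β]
    [NormedAddCommGroup E] [NormedSpace ℝ E] (κ : Kernel α β) (μ : Measure α) {X : β → E}
    (hX : Integrable X (μ.bind κ)) : ∫ ω, X ω ∂(μ.bind κ) = ∫ x, ∫ ω, X ω ∂(κ x) ∂μ := by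
  have hcomp := Kernel.integral_comp (η := κ) (κ := Kernel.const Unit μ) (a := ()) (f := X)
  simpa only [Kernel.comp_apply, Kernel.const_apply] using
    hcomp (by simpa only [Kernel.comp_apply, Kernel.const_apply] using hX)

variable [TopologicalSpace S]

theorem IsFellerProcess.measurable (hV : IsFellerProcess 𝓕 V P) (t : ℝ≥0) : Measurable (V t) :=
  (hV.adapted t).mono (𝓕.le t) le_rfl

theorem IsFellerProcess.isMarkovKernel (hV : IsFellerProcess 𝓕 V P) : IsMarkovKernel P :=
  ⟨hV.prob⟩

theorem IsFellerProcess.integral_mul_add (hV : IsFellerProcess 𝓕 V P) {h φ : S → ℝ}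
    (hh : Measurable h) (hφ : Measurable φ) {B M : ℝ} (hB : ∀ y, |h y| ≤ B)
    (hM : ∀ y, |φ y| ≤ M) (s t : ℝ≥0) (x : S) :
    ∫ ω, h (V s ω) * φ (V (s + t) ω) ∂(P x) =
      semigroup V P s (fun y => h y * semigroup V P t φ y) x := by
  have := hV.isMarkovKernel
  have hint : Integrable (fun ω => φ (V (s + t) ω)) (P x) :=
    Integrable.of_bound (hφ.comp (hV.measurable _)).aestronglyMeasurable M
      (Eventually.of_forall fun ω => hM _)
  have hmul : Integrable ((fun ω => h (V s ω)) * fun ω => φ (V (s + t) ω)) (P x) :=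
    hint.bdd_mul (hh.comp (hV.measurable s)).aestronglyMeasurable
      (Eventually.of_forall fun ω => hB (V s ω))
  have hpull := condExp_mul_of_stronglyMeasurable_left
    (hh.comp (hV.adapted s)).stronglyMeasurable hmul hint
  refine (integral_condExp (𝓕.le s)).symm.trans (integral_congr_ae ?_)
  filter_upwards [hpull, hV.markov x s t φ hφ ⟨M, hM⟩] with ω hpullω hmarkovω
  exact hpullω.trans (congrArg (h (V s ω) * ·) hmarkovω)

theorem IsFellerProcess.semigroup_add (hV : IsFellerProcess 𝓕 V P) {φ : S → ℝ}
    (hφ : Measurable φ) {M : ℝ} (hM : ∀ y, |φ y| ≤ M) (s t : ℝ≥0) (x : S) :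
    semigroup V P (s + t) φ x = semigroup V P s (semigroup V P t φ) x := by
  simpa only [semigroup, one_mul] using
    hV.integral_mul_add (h := fun _ => 1) (B := 1) measurable_const hφ
    (fun _ => abs_one.le) hM s t x

theorem IsInvariantLaw.isProbabilityMeasure_bind (hV : IsFellerProcess 𝓕 V P)
    (hπ : IsInvariantLaw V P π) : IsProbabilityMeasure (π.bind P) := by
  have := hV.isMarkovKernel
  have := hπ.1
  infer_instance

theorem IsInvariantLaw.integral_comp (hV : IsFellerProcess 𝓕 V P) (hπ : IsInvariantLaw V P π)
    (t : ℝ≥0) {φ : S → ℝ} (hφ : Measurable φ) :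
    ∫ ω, φ (V t ω) ∂(π.bind P) = ∫ x, φ x ∂π := by
  have hmap : (π.bind P).map (V t) = π := by
    rw [Measure.map_comp _ _ (hV.measurable t)]
    exact hπ.2 t
  rw [← integral_map (hV.measurable t).aemeasurable hφ.aestronglyMeasurable, hmap]

variable [TopologicalSpace.PseudoMetrizableSpace S] [BorelSpace S]

theorem IsFellerProcess.measurable_uncurry (hV : IsFellerProcess 𝓕 V P) :
    Measurable (fun p : ℝ≥0 × Ω => V p.1 p.2) :=
  measurable_uncurry_of_rightContinuous hV.measurable fun ω => (hV.cadlag ω).1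

theorem IsFellerProcess.measurable_rescaled (hV : IsFellerProcess 𝓕 V P) (T : ℝ) :
    Measurable fun p : ℝ × Ω => V (T * p.1).toNNReal p.2 :=
  hV.measurable_uncurry.comp
    (((measurable_fst.const_mul T).real_toNNReal).prodMk measurable_snd)

theorem IsFellerProcess.measurable_semigroup (hV : IsFellerProcess 𝓕 V P) {φ : S → ℝ}
    (hφ : Measurable φ) : Measurable fun p : ℝ≥0 × S => semigroup V P p.1 φ p.2 := by
  have := hV.isMarkovKernel
  have hm : StronglyMeasurable fun q : (ℝ≥0 × S) × Ω => φ (V q.1.1 q.2) :=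
    (hφ.comp (hV.measurable_uncurry.comp
      (measurable_fst.fst.prodMk measurable_snd))).stronglyMeasurable
  exact (hm.integral_kernel_prod_right' (κ := P.comap Prod.snd measurable_snd)).measurable

end Semigroup

section UniqueErgodicity

variable {S : Type*} [MeasurableSpace S] {Ω : Type*} {mΩ : MeasurableSpace Ω}
  {𝓕 : Filtration ℝ≥0 mΩ} {V : ℝ≥0 → Ω → S} {P : Kernel S Ω} {π : Measure S}

/-- The law at a uniform random time in `[0, T]` of the process started at `x`, the approximate
invariant law of the Krylov–Bogoliubov argument. The time is written `T * r` with `r` uniform on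
`(0, 1]`. -/
noncomputable def occupation (V : ℝ≥0 → Ω → S) (P : Kernel S Ω) (x : S) (T : ℝ) : Measure S :=
  ((volume.restrict (Set.Ioc (0 : ℝ) 1)).prod (P x)).map fun p => V (T * p.1).toNNReal p.2

variable [TopologicalSpace S] [TopologicalSpace.MetrizableSpace S] [BorelSpace S]

theorem IsFellerProcess.isProbabilityMeasure_occupation (hV : IsFellerProcess 𝓕 V P) (x : S)
    (T : ℝ) : IsProbabilityMeasure (occupation V P x T) := by
  have := hV.prob x
  have : IsProbabilityMeasure (volume.restrict (Set.Ioc (0 : ℝ) 1)) := ⟨by simp⟩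
  exact Measure.isProbabilityMeasure_map (hV.measurable_rescaled T).aemeasurable

theorem IsFellerProcess.integral_occupation (hV : IsFellerProcess 𝓕 V P) {φ : S → ℝ}
    (hφ : Measurable φ) {M : ℝ} (hM : ∀ y, |φ y| ≤ M) (x : S) (T : ℝ) :
    ∫ y, φ y ∂(occupation V P x T) =
      ∫ r in (0 : ℝ)..1, semigroup V P (T * r).toNNReal φ x := by
  have := hV.prob x
  rw [occupation, integral_map (hV.measurable_rescaled T).aemeasurable
    hφ.aestronglyMeasurable, integral_prod, intervalIntegral.integral_of_le zero_le_one]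
  · rfl
  · exact Integrable.of_bound (hφ.comp (hV.measurable_rescaled T)).aestronglyMeasurable M
      (Eventually.of_forall fun p => hM _)

theorem IsFellerProcess.tendsto_integral_semigroup_sub_integral (hV : IsFellerProcess 𝓕 V P)
    (φ : BoundedContinuousFunction S ℝ) (t : ℝ≥0) (x : S) :
    Tendsto (fun T => (∫ y, semigroup V P t φ y ∂(occupation V P x T)) -
      ∫ y, φ y ∂(occupation V P x T)) atTop (𝓝 0) := by
  have := hV.isMarkovKernel
  have hφm : Measurable φ := φ.continuous.measurable
  have hφb : ∀ y, |φ y| ≤ ‖φ‖ := φ.norm_coe_le_norm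
  have hmt : Measurable (semigroup V P t φ) :=
    (hV.measurable_semigroup hφm).comp (measurable_const.prodMk measurable_id)
  have hm : Measurable fun s : ℝ => semigroup V P s.toNNReal φ x :=
    (hV.measurable_semigroup hφm).comp (measurable_real_toNNReal.prodMk measurable_const)
  refine (tendsto_average_shift_sub_average hm.aestronglyMeasurable
    (fun s => abs_semigroup_le hφb _ x) t).congr' ?_
  filter_upwards [eventually_ge_atTop 0] with T hT
  rw [hV.integral_occupation hφm hφb,
    hV.integral_occupation hmt (abs_semigroup_le hφb t)]
  congr 1
  refine intervalIntegral.integral_congr fun r hr => ?_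
  rw [Set.uIcc_of_le zero_le_one] at hr
  simp only [Real.toNNReal_add (mul_nonneg hT hr.1) t.coe_nonneg, Real.toNNReal_coe]
  exact hV.semigroup_add hφm hφb _ t x

theorem IsFellerProcess.isInvariantLaw_of_forall_integral_semigroup (hV : IsFellerProcess 𝓕 V P)
    {μ : Measure S} [IsProbabilityMeasure μ]
    (h : ∀ (φ : BoundedContinuousFunction S ℝ) t, ∫ y, semigroup V P t φ y ∂μ = ∫ y, φ y ∂μ) :
    IsInvariantLaw V P μ := by
  have := hV.isMarkovKernel
  refine ⟨inferInstance, fun t => ?_⟩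
  have : IsMarkovKernel (P.map (V t)) := Kernel.IsMarkovKernel.map _ (hV.measurable t)
  refine ext_of_forall_integral_eq_of_IsFiniteMeasure fun φ => ?_
  rw [integral_bind_kernel _ _ (φ.integrable _), ← h φ t]
  refine integral_congr_ae (Eventually.of_forall fun y => ?_)
  simp only [Kernel.map_apply _ (hV.measurable t)]
  exact integral_map (hV.measurable t).aemeasurable φ.continuous.aestronglyMeasurable

variable [CompactSpace S]

theorem IsFellerProcess.tendsto_integral_occupation (hV : IsFellerProcess 𝓕 V P)
    (huniq : ∀ μ : Measure S, IsInvariantLaw V P μ → μ = π) (φ : C(S, ℝ)) (x : S) :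
    Tendsto (fun T => ∫ y, φ y ∂(occupation V P x T)) atTop (𝓝 (∫ y, φ y ∂π)) := by
  rw [tendsto_iff_ultrafilter]
  intro U hU
  let μ : ℝ → ProbabilityMeasure S := fun T =>
    ⟨occupation V P x T, hV.isProbabilityMeasure_occupation x T⟩
  obtain ⟨μ₀, hμ₀⟩ : ∃ μ₀, Tendsto μ U (𝓝 μ₀) := ⟨_, (U.map μ).le_nhds_lim⟩
  rw [ProbabilityMeasure.tendsto_iff_forall_integral_tendsto] at hμ₀
  have hinv : IsInvariantLaw V P (μ₀ : Measure S) :=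
    hV.isInvariantLaw_of_forall_integral_semigroup fun ψ t => by
      have hsemigroup := hμ₀ (.mkOfCompact ⟨semigroup V P t ψ, hV.feller t ψ ψ.continuous⟩)
      exact eq_of_sub_eq_zero (tendsto_nhds_unique (hsemigroup.sub (hμ₀ ψ))
        ((hV.tendsto_integral_semigroup_sub_integral ψ t x).mono_left hU))
  rw [← huniq _ hinv]
  exact hμ₀ (.mkOfCompact φ)

theorem IsFellerProcess.tendsto_intervalIntegral_semigroup (hV : IsFellerProcess 𝓕 V P)
    (huniq : ∀ μ : Measure S, IsInvariantLaw V P μ → μ = π) (φ : C(S, ℝ)) (x : S) {a : ℝ}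
    (ha : 0 ≤ a) :
    Tendsto (fun T => ∫ r in (0 : ℝ)..a, semigroup V P (T * r).toNNReal φ x) atTop
      (𝓝 (a * ∫ y, φ y ∂π)) := by
  rcases ha.eq_or_lt with rfl | ha
  · simp
  refine (((hV.tendsto_integral_occupation huniq φ x).comp
    (tendsto_id.atTop_mul_const ha)).const_mul a).congr fun T => ?_
  have hscale := intervalIntegral.integral_comp_mul_left (a := 0) (b := 1)
    (fun r => semigroup V P (T * r).toNNReal φ x) ha.ne'
  simp only [← mul_assoc, mul_zero, mul_one, smul_eq_mul] at hscale
  rw [Function.comp_apply, hV.integral_occupation φ.continuous.measurable φ.norm_coe_le_norm]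
  simp only [id, hscale, ← mul_assoc, mul_inv_cancel₀ ha.ne', one_mul]

end UniqueErgodicity

section MeanErgodic

variable {S : Type*} [MeasurableSpace S] {Ω : Type*} {mΩ : MeasurableSpace Ω}
  {𝓕 : Filtration ℝ≥0 mΩ} {V : ℝ≥0 → Ω → S} {P : Kernel S Ω} {π : Measure S}

/-- The stationary correlation `E_π[h(V_s) h(V_{s+t})] = ∫ h · P_t h dπ` of the observable `h` at
two times that differ by `t`, extended to negative `t` as an even function. -/
noncomputable def autocorrelation (V : ℝ≥0 → Ω → S) (P : Kernel S Ω) (π : Measure S) (h : S → ℝ)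
    (t : ℝ) : ℝ :=
  ∫ x, h x * semigroup V P |t|.toNNReal h x ∂π

theorem autocorrelation_neg (h : S → ℝ) (t : ℝ) :
    autocorrelation V P π h (-t) = autocorrelation V P π h t := by
  simp only [autocorrelation, abs_neg]

theorem abs_mul_le_mul_self {a b M : ℝ} (ha : |a| ≤ M) (hb : |b| ≤ M) : |a * b| ≤ M * M := by
  rw [abs_mul]
  exact mul_le_mul ha hb (abs_nonneg _) ((abs_nonneg _).trans ha)

theorem abs_autocorrelation_le [IsMarkovKernel P] [IsProbabilityMeasure π] {h : S → ℝ} {M : ℝ}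
    (hM : ∀ y, |h y| ≤ M) (t : ℝ) : |autocorrelation V P π h t| ≤ M * M :=
  norm_integral_le_of_bound (ρ := π) (X := fun x => h x * semigroup V P |t|.toNNReal h x)
    fun x => abs_mul_le_mul_self (hM x) (abs_semigroup_le hM _ x)

variable [TopologicalSpace S] [TopologicalSpace.PseudoMetrizableSpace S] [BorelSpace S]

theorem IsFellerProcess.measurable_mul_semigroup (hV : IsFellerProcess 𝓕 V P) {h : S → ℝ}
    (hh : Measurable h) :
    Measurable fun p : ℝ × S => h p.2 * semigroup V P |p.1|.toNNReal h p.2 :=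
  (hh.comp measurable_snd).mul ((hV.measurable_semigroup hh).comp
    ((continuous_abs.measurable.comp measurable_fst).real_toNNReal.prodMk measurable_snd))

theorem IsFellerProcess.measurable_autocorrelation [SFinite π] (hV : IsFellerProcess 𝓕 V P)
    {h : S → ℝ} (hh : Measurable h) : Measurable (autocorrelation V P π h) :=
  (hV.measurable_mul_semigroup hh).stronglyMeasurable.integral_prod_right'.measurable

theorem IsInvariantLaw.integral_mul_eq_autocorrelation (hV : IsFellerProcess 𝓕 V P)
    (hπ : IsInvariantLaw V P π) {h : S → ℝ} (hh : Measurable h) {M : ℝ} (hM : ∀ y, |h y| ≤ M)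
    (s t : ℝ≥0) :
    ∫ ω, h (V s ω) * h (V t ω) ∂(π.bind P) = autocorrelation V P π h (t - s) := by
  wlog hst : s ≤ t generalizing s t
  · rw [← neg_sub, autocorrelation_neg, ← this t s (le_of_not_ge hst)]
    simp only [mul_comm]
  obtain ⟨r, rfl⟩ := exists_add_of_le hst
  have := hV.isMarkovKernel
  have := hπ.isProbabilityMeasure_bind hV
  have hprod : Measurable fun y => h y * semigroup V P r h y :=
    hh.mul ((hV.measurable_semigroup hh).comp (measurable_const.prodMk measurable_id))
  have hint : Integrable (fun ω => h (V s ω) * h (V (s + r) ω)) (π.bind P) :=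
    .of_bound ((hh.comp (hV.measurable s)).mul
      (hh.comp (hV.measurable (s + r)))).aestronglyMeasurable (M * M)
      (Eventually.of_forall fun ω => abs_mul_le_mul_self (hM _) (hM _))
  have hint' : Integrable (fun ω => h (V s ω) * semigroup V P r h (V s ω)) (π.bind P) :=
    .of_bound (hprod.comp (hV.measurable s)).aestronglyMeasurable (M * M)
      (Eventually.of_forall fun ω => abs_mul_le_mul_self (hM _) (abs_semigroup_le hM r _))
  have hgap : |((s + r : ℝ≥0) : ℝ) - s|.toNNReal = r := by simp
  rw [autocorrelation, hgap, ← hπ.integral_comp hV s hprod, integral_bind_kernel P π hint,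
    integral_bind_kernel P π hint']
  simp only [hV.integral_mul_add hh hh hM hM, semigroup]

theorem IsInvariantLaw.integral_average (hV : IsFellerProcess 𝓕 V P) (hπ : IsInvariantLaw V P π)
    {h : S → ℝ} (hh : Measurable h) {M : ℝ} (hM : ∀ y, |h y| ≤ M) (T a b : ℝ) :
    ∫ ω, (∫ r in a..b, h (V (T * r).toNNReal ω)) ∂(π.bind P) = (b - a) * ∫ y, h y ∂π := by
  have := hπ.isProbabilityMeasure_bind hV
  rw [integral_intervalIntegral_swap (X := fun r ω => h (V (T * r).toNNReal ω))
    (hh.comp (hV.measurable_rescaled T)).stronglyMeasurable fun _ _ => hM _]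
  simp only [hπ.integral_comp hV _ hh, intervalIntegral.integral_const, smul_eq_mul]

theorem IsInvariantLaw.integral_sq_average (hV : IsFellerProcess 𝓕 V P)
    (hπ : IsInvariantLaw V P π) {h : S → ℝ} (hh : Measurable h) {M : ℝ} (hM : ∀ y, |h y| ≤ M)
    {T a b : ℝ} (hT : 0 ≤ T) (ha : 0 ≤ a) (hab : a ≤ b) :
    ∫ ω, (∫ r in a..b, h (V (T * r).toNNReal ω)) ^ 2 ∂(π.bind P) =
      ∫ s in a..b, ∫ r in a..b, autocorrelation V P π h (T * (r - s)) := by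
  have := hπ.isProbabilityMeasure_bind hV
  rw [integral_sq_intervalIntegral (X := fun r ω => h (V (T * r).toNNReal ω))
    (hh.comp (hV.measurable_rescaled T)).stronglyMeasurable fun _ _ => hM _]
  refine intervalIntegral.integral_congr fun s hs => intervalIntegral.integral_congr fun r hr => ?_
  rw [Set.uIcc_of_le hab] at hs hr
  simp only [hπ.integral_mul_eq_autocorrelation hV hh hM,
    Real.coe_toNNReal _ (mul_nonneg hT (ha.trans hs.1)),
    Real.coe_toNNReal _ (mul_nonneg hT (ha.trans hr.1)), mul_sub]

end MeanErgodic

section MeanErgodicTheorem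

variable {S : Type*} [MeasurableSpace S] [TopologicalSpace S] [TopologicalSpace.MetrizableSpace S]
  [BorelSpace S] [CompactSpace S] {Ω : Type*} {mΩ : MeasurableSpace Ω}
  {𝓕 : Filtration ℝ≥0 mΩ} {V : ℝ≥0 → Ω → S} {P : Kernel S Ω} {π : Measure S}

theorem IsInvariantLaw.tendsto_intervalIntegral_autocorrelation_of_nonneg
    (hV : IsFellerProcess 𝓕 V P) (hπ : IsInvariantLaw V P π)
    (huniq : ∀ μ : Measure S, IsInvariantLaw V P μ → μ = π) (h : C(S, ℝ)) {a : ℝ} (ha : 0 ≤ a) :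
    Tendsto (fun T => ∫ r in (0 : ℝ)..a, autocorrelation V P π h (T * r)) atTop
      (𝓝 (a * (∫ y, h y ∂π) ^ 2)) := by
  have := hV.isMarkovKernel
  have := hπ.1
  have hm := hV.measurable_mul_semigroup h.continuous.measurable
  have hb := h.norm_coe_le_norm
  have hmT : ∀ T : ℝ, StronglyMeasurable fun p : ℝ × S =>
      h p.2 * semigroup V P |T * p.1|.toNNReal h p.2 := fun T =>
    (hm.comp ((measurable_fst.const_mul T).prodMk measurable_snd)).stronglyMeasurable
  have hbT : ∀ (T r : ℝ) (x : S), ‖h x * semigroup V P |T * r|.toNNReal h x‖ ≤ ‖h‖ * ‖h‖ :=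
    fun T r x => abs_mul_le_mul_self (hb x) (abs_semigroup_le hb _ x)
  have hswap : ∀ T : ℝ, ∫ r in (0 : ℝ)..a, autocorrelation V P π h (T * r) =
      ∫ x, (∫ r in (0 : ℝ)..a, h x * semigroup V P |T * r|.toNNReal h x) ∂π := fun T =>
    (integral_intervalIntegral_swap (hmT T) (hbT T) 0 a).symm
  have hlim : a * (∫ y, h y ∂π) ^ 2 = ∫ x, h x * (a * ∫ y, h y ∂π) ∂π := by
    rw [integral_mul_const]
    ring
  simp only [hswap, hlim]
  refine tendsto_integral_filter_of_dominated_convergence (fun _ => ‖h‖ * ‖h‖ * |a - 0|)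
    (Eventually.of_forall fun T =>
      (stronglyMeasurable_intervalIntegral (hmT T) 0 a).aestronglyMeasurable)
    (Eventually.of_forall fun T => Eventually.of_forall fun x =>
      intervalIntegral.norm_integral_le_of_norm_le_const fun r _ => hbT T r x)
    (integrable_const _) (Eventually.of_forall fun x => ?_)
  refine ((hV.tendsto_intervalIntegral_semigroup huniq h x ha).const_mul (h x)).congr' ?_
  filter_upwards [eventually_ge_atTop 0] with T hT
  rw [← intervalIntegral.integral_const_mul]
  refine intervalIntegral.integral_congr fun r hr => ?_
  rw [Set.uIcc_of_le ha] at hr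
  simp only [abs_of_nonneg (mul_nonneg hT hr.1)]

theorem IsInvariantLaw.tendsto_intervalIntegral_autocorrelation
    (hV : IsFellerProcess 𝓕 V P) (hπ : IsInvariantLaw V P π)
    (huniq : ∀ μ : Measure S, IsInvariantLaw V P μ → μ = π) (h : C(S, ℝ)) (a b : ℝ) :
    Tendsto (fun T => ∫ r in a..b, autocorrelation V P π h (T * r)) atTop
      (𝓝 ((b - a) * (∫ y, h y ∂π) ^ 2)) := by
  have := hV.isMarkovKernel
  have := hπ.1
  have hzero : ∀ c, Tendsto (fun T => ∫ r in (0 : ℝ)..c, autocorrelation V P π h (T * r)) atTop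
      (𝓝 (c * (∫ y, h y ∂π) ^ 2)) := fun c => by
    rcases le_total 0 c with hc | hc
    · exact hπ.tendsto_intervalIntegral_autocorrelation_of_nonneg hV huniq h hc
    · have hneg := (hπ.tendsto_intervalIntegral_autocorrelation_of_nonneg hV huniq h
        (neg_nonneg.2 hc)).neg
      rw [neg_mul, neg_neg] at hneg
      refine hneg.congr fun T => ?_
      have hreflect := intervalIntegral.integral_comp_neg (a := 0) (b := -c)
        fun r => autocorrelation V P π h (T * r)
      simp only [mul_neg, autocorrelation_neg, neg_neg, neg_zero] at hreflect
      rw [hreflect, intervalIntegral.integral_symm 0 c]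
      exact neg_neg _
  have hint : ∀ T c d, IntervalIntegrable (fun r => autocorrelation V P π h (T * r)) volume c d :=
    fun T => intervalIntegrable_of_bound ((hV.measurable_autocorrelation
      h.continuous.measurable).comp (measurable_const_mul T)).aestronglyMeasurable
      fun r => abs_autocorrelation_le h.norm_coe_le_norm _
  rw [sub_mul]
  exact ((hzero b).sub (hzero a)).congr fun T =>
    intervalIntegral.integral_interval_sub_left (hint T 0 b) (hint T 0 a)

theorem IsInvariantLaw.tendsto_integral_sq_average (hV : IsFellerProcess 𝓕 V P)
    (hπ : IsInvariantLaw V P π) (huniq : ∀ μ : Measure S, IsInvariantLaw V P μ → μ = π)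
    (h : C(S, ℝ)) {a b : ℝ} (ha : 0 ≤ a) (hab : a ≤ b) :
    Tendsto (fun T : ℝ => ∫ ω, (∫ r in a..b, h (V (T * r).toNNReal ω)) ^ 2 ∂(π.bind P)) atTop
      (𝓝 (((b - a) * ∫ y, h y ∂π) ^ 2)) := by
  have := hV.isMarkovKernel
  have := hπ.1
  have hb : ∀ t, ‖autocorrelation V P π h t‖ ≤ ‖h‖ * ‖h‖ :=
    abs_autocorrelation_le h.norm_coe_le_norm
  have hm : ∀ T : ℝ, StronglyMeasurable fun p : ℝ × ℝ =>
      autocorrelation V P π h (T * (p.1 - p.2)) := fun T =>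
    ((hV.measurable_autocorrelation h.continuous.measurable).comp
      ((measurable_fst.sub measurable_snd).const_mul T)).stronglyMeasurable
  have hlim : ((b - a) * ∫ y, h y ∂π) ^ 2 = ∫ _ in a..b, (b - a) * (∫ y, h y ∂π) ^ 2 := by
    rw [intervalIntegral.integral_const, smul_eq_mul]
    ring
  rw [hlim]
  have hiterated : Tendsto (fun T : ℝ => ∫ s in a..b, ∫ r in a..b,
      autocorrelation V P π h (T * (r - s))) atTop
      (𝓝 (∫ _ in a..b, (b - a) * (∫ y, h y ∂π) ^ 2)) := by
    refine intervalIntegral.tendsto_integral_filter_of_dominated_convergence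
      (fun _ => ‖h‖ * ‖h‖ * |b - a|)
      (Eventually.of_forall fun T =>
        (stronglyMeasurable_intervalIntegral (hm T) a b).aestronglyMeasurable)
      (Eventually.of_forall fun T => Eventually.of_forall fun s _ =>
        intervalIntegral.norm_integral_le_of_norm_le_const fun r _ => hb _)
      intervalIntegrable_const (Eventually.of_forall fun s _ => ?_)
    have hshift := hπ.tendsto_intervalIntegral_autocorrelation hV huniq h (a - s) (b - s)
    rw [sub_sub_sub_cancel_right] at hshift
    exact hshift.congr fun T => (intervalIntegral.integral_comp_sub_right
      (fun r => autocorrelation V P π h (T * r)) s).symm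
  refine hiterated.congr' ?_
  filter_upwards [eventually_ge_atTop 0] with T hT
  exact (hπ.integral_sq_average hV h.continuous.measurable h.norm_coe_le_norm hT ha hab).symm

theorem IsInvariantLaw.tendsto_average_inMeasure (hV : IsFellerProcess 𝓕 V P)
    (hπ : IsInvariantLaw V P π) (huniq : ∀ μ : Measure S, IsInvariantLaw V P μ → μ = π)
    (h : C(S, ℝ)) {a b : ℝ} (ha : 0 ≤ a) (hab : a ≤ b) :
    Tendsto (fun p : ℝ × Ω => ∫ r in a..b, h (V (p.1 * r).toNNReal p.2))
      (inMeasure atTop (π.bind P)) (𝓝 ((b - a) * ∫ y, h y ∂π)) := by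
  have := hπ.isProbabilityMeasure_bind hV
  have hh := h.continuous.measurable
  have hLp : ∀ T : ℝ, MemLp (fun ω => ∫ r in a..b, h (V (T * r).toNNReal ω)) 2 (π.bind P) :=
    fun T => .of_bound (stronglyMeasurable_intervalIntegral (hh.comp
      (hV.measurable_rescaled T)).stronglyMeasurable a b).aestronglyMeasurable (‖h‖ * |b - a|)
      (Eventually.of_forall fun ω => intervalIntegral.norm_integral_le_of_norm_le_const
        fun r _ => h.norm_coe_le_norm _)
  have hmean := fun T => hπ.integral_average hV hh h.norm_coe_le_norm T a b
  refine tendsto_inMeasure_of_variance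
    (X := fun T ω => ∫ r in a..b, h (V (T * r).toNNReal ω)) (Eventually.of_forall hLp)
    (Eventually.of_forall hmean) ?_
  simp only [variance_eq_sub (hLp _), hmean, Pi.pow_apply]
  have hsub := (hπ.tendsto_integral_sq_average hV huniq h ha hab).sub_const
    (((b - a) * ∫ y, h y ∂π) ^ 2)
  rwa [sub_self] at hsub

end MeanErgodicTheorem

section Averaging

variable {E : Type*} [NormedAddCommGroup E] [NormedSpace ℝ E]

/-- The time-dependent vector field `u` is integrable along every continuous curve, the condition
under which the integral equation `SolvesDescent` is free of junk values. -/
def IntegrableAlongCurves (u : ℝ → E → E) : Prop :=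
  ∀ ⦃c : ℝ → E⦄, Continuous c → ∀ a b, IntervalIntegrable (fun s => u s (c s)) volume a b

/-- The path `c` solves `dc_t = -u_t(c_t) dt`, `c_0 = x₀`, in integral form. -/
def SolvesDescent (u : ℝ → E → E) (x₀ : E) (c : C(ℝ≥0, E)) : Prop :=
  ∀ t : ℝ≥0, c t = x₀ - ∫ s in (0 : ℝ)..t, u s (c s.toNNReal)

theorem le_mul_exp_of_le_add_mul_integral {w : ℝ → ℝ} (hw : Continuous w) {r L τ : ℝ} (hL : 0 ≤ L)
    (h : ∀ t ∈ Set.Icc 0 τ, w t ≤ r + L * ∫ s in (0 : ℝ)..t, w s) {t : ℝ}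
    (ht : t ∈ Set.Icc 0 τ) : w t ≤ r * Real.exp (L * t) := by
  have hderiv : ∀ x, HasDerivAt (fun t => r + L * ∫ s in (0 : ℝ)..t, w s) (L * w x) x := fun x =>
    ((hw.integral_hasStrictDerivAt 0 x).hasDerivAt.const_mul L).const_add r
  have hgronwall := le_gronwallBound_of_liminf_deriv_right_le (δ := r) (K := L) (ε := 0)
    (fun x _ => (hderiv x).continuousAt.continuousWithinAt)
    (fun x _ _ hx => (hderiv x).hasDerivWithinAt.liminf_right_slope_le hx) (by simp)
    (fun x hx => by simpa using mul_le_mul_of_nonneg_left (h x (Set.Ico_subset_Icc_self hx)) hL)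
    t ht
  rw [gronwallBound_ε0, sub_zero] at hgronwall
  exact (h t ht).trans hgronwall

theorem norm_sub_le_of_solvesDescent {u u' : ℝ → E → E} (hu : IntegrableAlongCurves u)
    (hu' : IntegrableAlongCurves u') {L : ℝ≥0} (hL : ∀ s, LipschitzWith L (u s)) {x₀ : E}
    {c z : C(ℝ≥0, E)} (hc : SolvesDescent u x₀ c) (hz : SolvesDescent u' x₀ z) {τ r : ℝ}
    (hr : ∀ t ∈ Set.Icc 0 τ,
      ‖∫ s in (0 : ℝ)..t, (u s (z s.toNNReal) - u' s (z s.toNNReal))‖ ≤ r)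
    {t : ℝ≥0} (ht : (t : ℝ) ≤ τ) : ‖c t - z t‖ ≤ r * Real.exp (L * t) := by
  have hcont : ∀ q : C(ℝ≥0, E), Continuous fun s : ℝ => q s.toNNReal := fun q => by fun_prop
  have hw : Continuous fun s : ℝ => ‖c s.toNNReal - z s.toNNReal‖ :=
    ((hcont c).sub (hcont z)).norm
  have hgrowth : ∀ t ∈ Set.Icc 0 τ, ‖c t.toNNReal - z t.toNNReal‖ ≤
      r + L * ∫ s in (0 : ℝ)..t, ‖c s.toNNReal - z s.toNNReal‖ := fun t ht => by
    have hsplit : c t.toNNReal - z t.toNNReal =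
        -(∫ s in (0 : ℝ)..t, (u s (z s.toNNReal) - u' s (z s.toNNReal))) -
          ∫ s in (0 : ℝ)..t, (u s (c s.toNNReal) - u s (z s.toNNReal)) := by
      rw [hc, hz, Real.coe_toNNReal t ht.1,
        intervalIntegral.integral_sub (hu (hcont z) _ _) (hu' (hcont z) _ _),
        intervalIntegral.integral_sub (hu (hcont c) _ _) (hu (hcont z) _ _)]
      abel
    have hlip : ‖∫ s in (0 : ℝ)..t, (u s (c s.toNNReal) - u s (z s.toNNReal))‖ ≤
        ∫ s in (0 : ℝ)..t, L * ‖c s.toNNReal - z s.toNNReal‖ :=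
      intervalIntegral.norm_integral_le_of_norm_le ht.1
        (Eventually.of_forall fun s _ => (hL s).norm_sub_le _ _)
        ((hw.const_mul _).intervalIntegrable _ _)
    rw [intervalIntegral.integral_const_mul] at hlip
    rw [hsplit]
    exact (norm_sub_le _ _).trans (add_le_add ((norm_neg _).trans_le (hr t ht)) hlip)
  simpa only [Real.toNNReal_coe] using
    le_mul_exp_of_le_add_mul_integral hw L.coe_nonneg hgrowth ⟨t.coe_nonneg, ht⟩

theorem norm_integral_sub_sum_integral_le {f : ℝ → E} {g : ℕ → ℝ → E} {a : ℕ → ℝ}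
    (ha : Monotone a) (hf : ∀ a b, IntervalIntegrable f volume a b)
    (hg : ∀ j a b, IntervalIntegrable (g j) volume a b) {N : ℕ} {η : ℝ}
    (h : ∀ j < N, ∀ s ∈ Set.Ioc (a j) (a (j + 1)), ‖f s - g j s‖ ≤ η) :
    ‖(∫ s in a 0..a N, f s) - ∑ j ∈ Finset.range N, ∫ s in a j..a (j + 1), g j s‖ ≤
      η * (a N - a 0) := by
  rw [← intervalIntegral.sum_integral_adjacent_intervals fun _ _ => hf _ _,
    ← Finset.sum_sub_distrib, ← Finset.sum_range_sub, Finset.mul_sum]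
  refine norm_sum_le_of_le _ fun j hj => ?_
  have hstep := ha j.le_succ
  rw [← intervalIntegral.integral_sub (hf _ _) (hg _ _ _), ← abs_of_nonneg (sub_nonneg.2 hstep)]
  refine intervalIntegral.norm_integral_le_of_norm_le_const fun s hs => ?_
  rw [Set.uIoc_of_le hstep] at hs
  exact h j (Finset.mem_range.1 hj) s hs

theorem exists_grid_dist_le {X : Type*} [PseudoMetricSpace X] {z : ℝ → X} (hz : Continuous z)
    {t : ℝ} (ht : 0 ≤ t) {η : ℝ} (hη : 0 < η) :
    ∃ (a : ℕ → ℝ) (N : ℕ), Monotone a ∧ a 0 = 0 ∧ a N = t ∧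
      ∀ j < N, ∀ s ∈ Set.Ioc (a j) (a (j + 1)), dist (z s) (z (a j)) ≤ η := by
  obtain ⟨d, hd, hzd⟩ := Metric.uniformContinuousOn_iff.1
    (isCompact_Icc.uniformContinuousOn_of_continuous (s := Set.Icc 0 t) hz.continuousOn) η hη
  obtain ⟨N, hNd, hN⟩ := (((tendsto_const_div_atTop_nhds_zero_nat t).eventually_lt_const hd).and
    (eventually_gt_atTop 0)).exists
  have hN' : (0 : ℝ) < N := by exact_mod_cast hN
  have hmono : Monotone fun j : ℕ => (j : ℝ) * (t / N) := fun i j hij =>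
    mul_le_mul_of_nonneg_right (Nat.cast_le.2 hij) (div_nonneg ht hN'.le)
  have hlast : (N : ℝ) * (t / N) = t := mul_div_cancel₀ _ hN'.ne'
  refine ⟨fun j => j * (t / N), N, hmono, by simp, hlast, fun j hj s hs => ?_⟩
  have hleft : (0 : ℝ) ≤ j * (t / N) := by positivity
  have hright : ((j + 1 : ℕ) : ℝ) * (t / N) ≤ t := (hmono hj).trans_eq hlast
  refine (hzd s ⟨hleft.trans hs.1.le, hs.2.trans hright⟩ _
    ⟨hleft, (hs.1.le.trans hs.2).trans hright⟩ ?_).le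
  rw [Real.dist_eq, abs_of_pos (sub_pos.2 hs.1), sub_lt_iff_lt_add]
  refine hs.2.trans_lt ?_
  push_cast
  linarith

variable {κ : Type*} {l : Filter κ}

theorem tendsto_integral_along_curve {D : κ → ℝ → E → E} (hD : ∀ k, IntegrableAlongCurves (D k))
    {K : ℝ≥0} (hK : ∀ k s, LipschitzWith K (D k s))
    (hlim : ∀ x a b, 0 ≤ a → a ≤ b → Tendsto (fun k => ∫ s in a..b, D k s x) l (𝓝 0))
    {z : ℝ → E} (hz : Continuous z) {t : ℝ} (ht : 0 ≤ t) :
    Tendsto (fun k => ∫ s in (0 : ℝ)..t, D k s (z s)) l (𝓝 0) := by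
  rw [Metric.tendsto_nhds]
  intro ε hε
  obtain ⟨η, hη, hηε⟩ : ∃ η > 0, K * η * t < ε / 2 := by
    have hsmall : Tendsto (fun η : ℝ => K * η * t) (𝓝[>] 0) (𝓝 (K * 0 * t)) :=
      ((continuous_const.mul continuous_id).mul_const t).tendsto 0 |>.mono_left nhdsWithin_le_nhds
    rw [mul_zero, zero_mul] at hsmall
    exact (eventually_mem_nhdsWithin.and (hsmall.eventually_lt_const (half_pos hε))).exists
  obtain ⟨a, N, ha, ha0, haN, hgrid⟩ := exists_grid_dist_le hz ht hη
  have hfrozen : Tendsto (fun k => ∑ j ∈ Finset.range N,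
      ∫ s in a j..a (j + 1), D k s (z (a j))) l (𝓝 0) := by
    simpa using tendsto_finsetSum (Finset.range N) fun j _ => hlim (z (a j)) (a j) (a (j + 1))
      (ha0.symm.trans_le (ha j.zero_le)) (ha j.le_succ)
  filter_upwards [Metric.tendsto_nhds.1 hfrozen (ε / 2) (half_pos hε)] with k hk
  have hfreeze := norm_integral_sub_sum_integral_le ha (hD k hz)
    (fun j => hD k (continuous_const (y := z (a j)))) (N := N) (η := K * η) fun j hj s hs =>
      ((hK k s).norm_sub_le _ _).trans (mul_le_mul_of_nonneg_left
        ((dist_eq_norm _ _).symm.trans_le (hgrid j hj s hs)) K.coe_nonneg)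
  rw [ha0, haN, sub_zero] at hfreeze
  rw [dist_zero_right] at hk ⊢
  linarith [norm_le_norm_sub_add (∫ s in (0 : ℝ)..t, D k s (z s))
    (∑ j ∈ Finset.range N, ∫ s in a j..a (j + 1), D k s (z (a j)))]

theorem tendstoUniformlyOn_of_lipschitzOnWith {X Y : Type*} [PseudoMetricSpace X]
    [PseudoMetricSpace Y] {F : κ → X → Y} {f : X → Y} {A : Set X} (hA : IsCompact A) {C : ℝ≥0}
    (hF : ∀ k, LipschitzOnWith C (F k) A) (hlim : ∀ x ∈ A, Tendsto (fun k => F k x) l (𝓝 (f x))) :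
    TendstoUniformlyOn F f l A := by
  have := isCompact_iff_compactSpace.1 hA
  have hequi : Equicontinuous fun k => A.domRestrict (F k) :=
    (LipschitzWith.uniformEquicontinuous _ C fun k =>
      lipschitzOnWith_iff_restrict.1 (hF k)).equicontinuous
  rw [tendstoUniformlyOn_iff_restrict]
  exact UniformFun.tendsto_iff_tendstoUniformly.1 ((hequi.tendsto_uniformFun_iff_pi l _).2
    (tendsto_pi_nhds.2 fun x => hlim x x.2))

theorem tendstoUniformlyOn_integral_along_curve {D : κ → ℝ → E → E}
    (hD : ∀ k, IntegrableAlongCurves (D k)) {K : ℝ≥0} (hK : ∀ k s, LipschitzWith K (D k s)) {M : ℝ}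
    (hM : ∀ k s, ‖D k s 0‖ ≤ M)
    (hlim : ∀ x a b, 0 ≤ a → a ≤ b → Tendsto (fun k => ∫ s in a..b, D k s x) l (𝓝 0))
    {z : ℝ → E} (hz : Continuous z) (τ : ℝ) :
    TendstoUniformlyOn (fun k t => ∫ s in (0 : ℝ)..t, D k s (z s)) 0 l (Set.Icc 0 τ) := by
  obtain ⟨B, hB⟩ := (isCompact_Icc (a := 0) (b := τ)).exists_bound_of_continuousOn hz.continuousOn
  have hbound : ∀ k, ∀ s ∈ Set.Icc 0 τ, ‖D k s (z s)‖ ≤ K * B + M := fun k s hs => by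
    have hincrement := (hK k s).norm_sub_le (z s) 0
    rw [sub_zero] at hincrement
    linarith [norm_le_norm_sub_add (D k s (z s)) (D k s 0), hM k s,
      mul_le_mul_of_nonneg_left (hB s hs) K.coe_nonneg]
  refine tendstoUniformlyOn_of_lipschitzOnWith isCompact_Icc
    (C := (K * B + M).toNNReal) (fun k => .of_dist_le_mul fun t ht t' ht' => ?_)
    fun t ht => tendsto_integral_along_curve hD hK hlim hz ht.1
  rw [dist_eq_norm, intervalIntegral.integral_interval_sub_left (hD k hz _ _) (hD k hz _ _)]
  refine intervalIntegral.norm_integral_le_of_norm_le_const fun s hs => ?_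
  exact (hbound k s (Set.uIcc_subset_Icc ht' ht (Set.uIoc_subset_uIcc hs))).trans
    (Real.le_coe_toNNReal _)

theorem tendsto_of_solvesDescent [CompleteSpace E] {u : κ → ℝ → E → E} {ubar : E → E}
    (hu : ∀ k, IntegrableAlongCurves (u k)) {L : ℝ≥0} (hL : ∀ k s, LipschitzWith L (u k s))
    (hLbar : LipschitzWith L ubar) {M : ℝ} (hM : ∀ k s, ‖u k s 0‖ ≤ M)
    (hlim : ∀ x a b, 0 ≤ a → a ≤ b →
      Tendsto (fun k => ∫ s in a..b, u k s x) l (𝓝 ((b - a) • ubar x)))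
    {x₀ : E} {c : κ → C(ℝ≥0, E)} {ζ : C(ℝ≥0, E)}
    (hc : ∀ᶠ k in l, SolvesDescent (u k) x₀ (c k)) (hζ : SolvesDescent (fun _ => ubar) x₀ ζ) :
    Tendsto c l (𝓝 ζ) := by
  have hubar : IntegrableAlongCurves fun _ => ubar := fun z hz a b =>
    (hLbar.continuous.comp hz).intervalIntegrable a b
  have hlimD : ∀ x a b, 0 ≤ a → a ≤ b →
      Tendsto (fun k => ∫ s in a..b, (u k s x - ubar x)) l (𝓝 0) := fun x a b ha hab => by
    have hsub := (hlim x a b ha hab).sub_const ((b - a) • ubar x)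
    rw [sub_self] at hsub
    refine hsub.congr fun k => ?_
    rw [intervalIntegral.integral_sub (hu k continuous_const a b) intervalIntegrable_const,
      intervalIntegral.integral_const]
  rw [ContinuousMap.tendsto_iff_forall_isCompact_tendstoUniformlyOn]
  intro A hA
  obtain ⟨τ, hτ⟩ := hA.bddAbove
  have hfluct := tendstoUniformlyOn_integral_along_curve (D := fun k s x => u k s x - ubar x)
    (fun k z hz a b => (hu k hz a b).sub (hubar hz a b)) (fun k s => (hL k s).sub hLbar)
    (fun k s => (norm_sub_le _ _).trans (add_le_add_left (hM k s) _)) hlimD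
    (z := fun s => ζ s.toNNReal) (by fun_prop) τ
  rw [Metric.tendstoUniformlyOn_iff] at hfluct ⊢
  intro η hη
  filter_upwards [hc, hfluct (η / 2 * Real.exp (-(L * τ))) (by positivity)] with k hck hk t ht
  have htτ : (t : ℝ) ≤ τ := hτ ht
  rw [dist_comm, dist_eq_norm]
  calc ‖c k t - ζ t‖ ≤ η / 2 * Real.exp (-(L * τ)) * Real.exp (L * t) :=
        norm_sub_le_of_solvesDescent (hu k) hubar (hL k) hck hζ
          (fun t ht => by simpa using (hk t ht).le) htτ
    _ ≤ η / 2 * Real.exp (-(L * τ)) * Real.exp (L * τ) := by gcongr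
    _ = η / 2 := by rw [mul_assoc, ← Real.exp_add, neg_add_cancel, Real.exp_zero, mul_one]
    _ < η := half_lt_self hη

end Averaging

section PathSpace

theorem mapsTo_iff_exists_inv_le_infEDist {X Y : Type*} [TopologicalSpace X]
    [PseudoEMetricSpace Y] {f : X → Y} (hf : Continuous f) {A D : Set X} (hA : IsCompact A)
    (hDA : D ⊆ A) (hAD : A ⊆ closure D) {U : Set Y} (hU : IsOpen U) :
    Set.MapsTo f A U ↔ ∃ n : ℕ, ∀ x ∈ D, (n : ℝ≥0∞)⁻¹ ≤ Metric.infEDist (f x) Uᶜ := by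
  have hcont : Continuous fun x => Metric.infEDist (f x) Uᶜ := Metric.continuous_infEDist.comp hf
  have hmem : ∀ x, f x ∈ U ↔ 0 < Metric.infEDist (f x) Uᶜ := fun x => by
    rw [Metric.infEDist_pos_iff_notMem_closure, hU.isClosed_compl.closure_eq, Set.notMem_compl_iff]
  constructor
  · intro hAU
    rcases A.eq_empty_or_nonempty with rfl | hne
    · exact ⟨0, fun x hx => (hDA hx).elim⟩
    obtain ⟨x₀, hx₀, hmin⟩ := hA.exists_isMinOn hne hcont.continuousOn
    obtain ⟨n, hn⟩ := ENNReal.exists_inv_nat_lt ((hmem x₀).1 (hAU hx₀)).ne'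
    exact ⟨n, fun x hx => hn.le.trans (hmin (hDA hx))⟩
  · rintro ⟨n, hn⟩ x hx
    have hclosed : IsClosed {x | (n : ℝ≥0∞)⁻¹ ≤ Metric.infEDist (f x) Uᶜ} :=
      isClosed_le continuous_const hcont
    exact (hmem x).2 ((ENNReal.inv_pos.2 (ENNReal.natCast_ne_top n)).trans_le
      (closure_minimal hn hclosed (hAD hx)))

theorem measurable_of_measurable_eval {X Y Ω : Type*} [TopologicalSpace X]
    [TopologicalSpace.PseudoMetrizableSpace X] [SecondCountableTopology X] [LocallyCompactSpace X]
    [PseudoEMetricSpace Y] [SecondCountableTopology Y] [MeasurableSpace Y] [OpensMeasurableSpace Y]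
    [MeasurableSpace C(X, Y)] [BorelSpace C(X, Y)] [MeasurableSpace Ω] {q : Ω → C(X, Y)}
    (hq : ∀ x, Measurable fun ω => q ω x) : Measurable q := by
  rw [BorelSpace.measurable_eq (α := C(X, Y)),
    borel_eq_generateFrom_of_subbasis ContinuousMap.compactOpen_eq]
  refine measurable_generateFrom ?_
  rintro _ ⟨A, hA : IsCompact A, U, hU : IsOpen U, rfl⟩
  obtain ⟨D, hDA, hD, hAD⟩ :=
    (TopologicalSpace.IsSeparable.of_separableSpace A).exists_countable_dense_subset
  have hpreimage : q ⁻¹' {f : C(X, Y) | Set.MapsTo f A U} =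
      ⋃ n : ℕ, ⋂ x ∈ D, {ω | (n : ℝ≥0∞)⁻¹ ≤ Metric.infEDist (q ω x) Uᶜ} := by
    ext ω
    simpa using mapsTo_iff_exists_inv_le_infEDist (q ω).continuous hA hDA hAD hU
  rw [hpreimage]
  exact MeasurableSet.iUnion fun n => MeasurableSet.biInter hD fun x _ =>
    measurableSet_le measurable_const (Metric.continuous_infEDist.measurable.comp (hq x))

theorem monotone_iSup_norm_sub {E : Type*} [NormedAddCommGroup E] (φ ψ : C(ℝ≥0, E)) :
    Monotone fun t : ℝ => ⨆ s : Set.Icc (0 : ℝ≥0) t.toNNReal, ‖φ s - ψ s‖ := fun t t' htt' => by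
  have hne : Nonempty (Set.Icc (0 : ℝ≥0) t.toNNReal) := ⟨⟨0, le_rfl, zero_le⟩⟩
  have hbdd : BddAbove (Set.range fun s : Set.Icc (0 : ℝ≥0) t'.toNNReal => ‖φ s - ψ s‖) :=
    (isCompact_range (by fun_prop)).bddAbove
  exact ciSup_le fun s =>
    le_ciSup hbdd ⟨s, s.2.1, s.2.2.trans (Real.toNNReal_le_toNNReal htt')⟩

theorem tendsto_iSup_norm_sub {E : Type*} [NormedAddCommGroup E] (φ : C(ℝ≥0, E)) (τ : ℝ≥0) :
    Tendsto (fun ψ : C(ℝ≥0, E) => ⨆ s : Set.Icc 0 τ, ‖φ s - ψ s‖) (𝓝 φ) (𝓝 0) := by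
  have hunif := Metric.tendstoUniformlyOn_iff.1 <|
    ContinuousMap.tendsto_iff_forall_isCompact_tendstoUniformlyOn.1 (tendsto_id (x := 𝓝 φ))
      (Set.Icc 0 τ) isCompact_Icc
  refine Metric.tendsto_nhds.2 fun η hη => ?_
  filter_upwards [hunif (η / 2) (half_pos hη)] with ψ hψ
  rw [Real.dist_0_eq_abs, abs_of_nonneg (Real.iSup_nonneg fun _ => norm_nonneg _)]
  refine (Real.iSup_le (fun s => ?_) (half_pos hη).le).trans_lt (half_lt_self hη)
  rw [← dist_eq_norm]
  exact (hψ s s.2).le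

variable {K : ℕ}

theorem tendsto_pathDist (φ : C(ℝ≥0, EuclideanSpace ℝ (Fin K))) :
    Tendsto (pathDist φ) (𝓝 φ) (𝓝 0) := by
  have hmeas : ∀ ψ : C(ℝ≥0, EuclideanSpace ℝ (Fin K)), Measurable fun t : ℝ =>
      Real.exp (-t) * min 1 (⨆ s : Set.Icc (0 : ℝ≥0) t.toNNReal, ‖φ s - ψ s‖) := fun ψ =>
    (Real.measurable_exp.comp measurable_neg).mul
      (measurable_const.min (monotone_iSup_norm_sub φ ψ).measurable)
  have hbound : ∀ (ψ : C(ℝ≥0, EuclideanSpace ℝ (Fin K))) (t : ℝ),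
      ‖Real.exp (-t) * min 1 (⨆ s : Set.Icc (0 : ℝ≥0) t.toNNReal, ‖φ s - ψ s‖)‖ ≤
        Real.exp (-t) := fun ψ t => by
    rw [Real.norm_of_nonneg (mul_nonneg (Real.exp_pos _).le
      (le_min zero_le_one (Real.iSup_nonneg fun _ => norm_nonneg _)))]
    exact mul_le_of_le_one_right (Real.exp_pos _).le (min_le_left _ _)
  have hpointwise : ∀ t : ℝ, Tendsto (fun ψ : C(ℝ≥0, EuclideanSpace ℝ (Fin K)) =>
      Real.exp (-t) * min 1 (⨆ s : Set.Icc (0 : ℝ≥0) t.toNNReal, ‖φ s - ψ s‖)) (𝓝 φ) (𝓝 0) :=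
    fun t => by
      simpa using ((tendsto_const_nhds (x := (1 : ℝ))).min
        (tendsto_iSup_norm_sub φ t.toNNReal)).const_mul (Real.exp (-t))
  have hexp : IntegrableOn (fun t : ℝ => Real.exp (-t)) (Set.Ioi 0) := by
    simpa using exp_neg_integrableOn_Ioi 0 one_pos
  have hlim := tendsto_integral_filter_of_dominated_convergence (fun t : ℝ => Real.exp (-t))
    (Eventually.of_forall fun ψ => (hmeas ψ).aestronglyMeasurable)
    (Eventually.of_forall fun ψ => Eventually.of_forall (hbound ψ)) hexp
    (Eventually.of_forall hpointwise)
  rwa [integral_zero] at hlim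

theorem PathContinuous.continuous {F : C(ℝ≥0, EuclideanSpace ℝ (Fin K)) → ℝ}
    (hF : PathContinuous F) : Continuous F :=
  continuous_iff_continuousAt.2 fun φ => Metric.tendsto_nhds.2 fun η hη => by
    obtain ⟨δ, hδ, h⟩ := hF φ η hη
    filter_upwards [(tendsto_pathDist φ).eventually_lt_const hδ] with ψ hψ
    rw [dist_comm]
    exact h ψ hψ

end PathSpace

section Picard

variable {E : Type*} [NormedAddCommGroup E] [NormedSpace ℝ E] {u : ℝ → E → E} {x₀ : E}

theorem IntegrableAlongCurves.continuous_iterate_picard (hu : IntegrableAlongCurves u) {c₀ : ℝ → E}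
    (hc₀ : Continuous c₀) (n : ℕ) : Continuous ((ODE.picard u 0 x₀)^[n] c₀) := by
  induction n with
  | zero => exact hc₀
  | succ n ih =>
    rw [Function.iterate_succ_apply']
    exact continuous_const.add (intervalIntegral.continuous_primitive (hu ih) 0)

theorem norm_iterate_picard_sub_le (hu : IntegrableAlongCurves u) {L : ℝ≥0}
    (hL : ∀ s, LipschitzWith L (u s)) {c₀ c : ℝ → E} (hc₀ : Continuous c₀) (hc : Continuous c)
    {τ B : ℝ} (hfix : Set.EqOn (ODE.picard u 0 x₀ c) c (Set.Icc 0 τ))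
    (hB : ∀ t ∈ Set.Icc 0 τ, ‖c₀ t - c t‖ ≤ B) (n : ℕ) {t : ℝ} (ht : t ∈ Set.Icc 0 τ) :
    ‖(ODE.picard u 0 x₀)^[n] c₀ t - c t‖ ≤ B * ((L * t) ^ n / n.factorial) := by
  induction n generalizing t with
  | zero => simpa using hB t ht
  | succ n ih =>
    set b := (ODE.picard u 0 x₀)^[n] c₀
    have hdiff : ODE.picard u 0 x₀ b t - c t = ∫ s in (0 : ℝ)..t, (u s (b s) - u s (c s)) := by
      rw [← hfix ht, ODE.picard_apply, ODE.picard_apply, add_sub_add_left_eq_sub,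
        intervalIntegral.integral_sub (hu (hu.continuous_iterate_picard hc₀ n) _ _) (hu hc _ _)]
    have hlip : ∀ s ∈ Set.Ioc 0 t,
        ‖u s (b s) - u s (c s)‖ ≤ L * (B * ((L * s) ^ n / n.factorial)) := fun s hs =>
      ((hL s).norm_sub_le _ _).trans
        (mul_le_mul_of_nonneg_left (ih ⟨hs.1.le, hs.2.trans ht.2⟩) L.coe_nonneg)
    have hcont : Continuous fun s : ℝ => L * (B * ((L * s) ^ n / n.factorial)) := by fun_prop
    rw [Function.iterate_succ_apply', hdiff]
    calc ‖∫ s in (0 : ℝ)..t, (u s (b s) - u s (c s))‖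
        ≤ ∫ s in (0 : ℝ)..t, L * (B * ((L * s) ^ n / n.factorial)) :=
          intervalIntegral.norm_integral_le_of_norm_le ht.1 (Eventually.of_forall hlip)
            (hcont.intervalIntegrable 0 t)
      _ = ∫ s in (0 : ℝ)..t, L * B * L ^ n / n.factorial * s ^ n :=
          intervalIntegral.integral_congr fun s _ => by ring
      _ = B * ((L * t) ^ (n + 1) / (n + 1).factorial) := by
          rw [intervalIntegral.integral_const_mul, integral_pow, Nat.factorial_succ]
          push_cast
          field_simp
          ring

theorem tendsto_iterate_picard (hu : IntegrableAlongCurves u) {L : ℝ≥0}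
    (hL : ∀ s, LipschitzWith L (u s)) {c₀ c : ℝ → E} (hc₀ : Continuous c₀) (hc : Continuous c)
    {t : ℝ} (ht : 0 ≤ t) (hfix : Set.EqOn (ODE.picard u 0 x₀ c) c (Set.Icc 0 t)) :
    Tendsto (fun n => (ODE.picard u 0 x₀)^[n] c₀ t) atTop (𝓝 (c t)) := by
  obtain ⟨B, hB⟩ := (isCompact_Icc (a := 0) (b := t)).exists_bound_of_continuousOn
    (hc₀.sub hc).continuousOn
  have hbound := (FloorSemiring.tendsto_pow_div_factorial_atTop ((L : ℝ) * t)).const_mul B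
  rw [mul_zero] at hbound
  exact tendsto_iff_norm_sub_tendsto_zero.2 (squeeze_zero (fun n => norm_nonneg _)
    (fun n => norm_iterate_picard_sub_le hu hL hc₀ hc hfix hB n ⟨ht, le_rfl⟩) hbound)

theorem SolvesDescent.picard_neg_eq {c : C(ℝ≥0, E)} (hc : SolvesDescent u x₀ c) {t : ℝ}
    (ht : 0 ≤ t) : ODE.picard (-u) 0 x₀ (fun s => c s.toNNReal) t = c t.toNNReal := by
  rw [hc, Real.coe_toNNReal t ht, ODE.picard_apply, sub_eq_add_neg, ← intervalIntegral.integral_neg]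
  rfl

variable [MeasurableSpace E] [BorelSpace E] [SecondCountableTopology E]
  {Ω : Type*} [MeasurableSpace Ω]

theorem measurable_iterate_picard {u : Ω → ℝ → E → E} (hu : ∀ ω, IntegrableAlongCurves (u ω))
    (hmeas : Measurable fun p : (ℝ × Ω) × E => u p.1.2 p.1.1 p.2) (n : ℕ) :
    Measurable fun p : ℝ × Ω => (ODE.picard (u p.2) 0 x₀)^[n] (fun _ => x₀) p.1 := by
  induction n with
  | zero => exact measurable_const
  | succ n ih =>
    refine measurable_uncurry_of_continuous_of_measurable
      (fun ω => (hu ω).continuous_iterate_picard continuous_const (n + 1)) fun t => ?_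
    simp only [Function.iterate_succ_apply', ODE.picard_apply]
    exact (stronglyMeasurable_intervalIntegral
      (hmeas.comp (measurable_id.prodMk ih)).stronglyMeasurable 0 t).measurable.const_add x₀

theorem aemeasurable_of_solvesDescent [MeasurableSpace C(ℝ≥0, E)] [BorelSpace C(ℝ≥0, E)]
    {ρ : Measure Ω} {u : Ω → ℝ → E → E} (hu : ∀ ω, IntegrableAlongCurves (u ω)) {L : ℝ≥0}
    (hL : ∀ ω s, LipschitzWith L (u ω s))
    (hmeas : Measurable fun p : (ℝ × Ω) × E => u p.1.2 p.1.1 p.2) {c : Ω → C(ℝ≥0, E)}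
    (hc : ∀ᵐ ω ∂ρ, SolvesDescent (u ω) x₀ (c ω)) : AEMeasurable c ρ := by
  obtain ⟨A, hA, hAm, hA0⟩ := exists_measurable_superset_of_null (ae_iff.1 hc)
  classical
  refine ⟨A.piecewise 0 c, measurable_of_measurable_eval fun t => ?_, ?_⟩
  · have hlim : ∀ ω ∉ A, Tendsto (fun n => (ODE.picard (-u ω) 0 x₀)^[n] (fun _ => x₀) t) atTop
        (𝓝 (c ω t)) := fun ω hω => by
      have hsol : SolvesDescent (u ω) x₀ (c ω) := not_not.1 fun h => hω (hA h)
      simpa using tendsto_iterate_picard (u := -u ω) (fun z hz a b => (hu ω hz a b).neg)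
        (fun s => (hL ω s).neg) continuous_const (c := fun s => c ω s.toNNReal) (by fun_prop)
        t.coe_nonneg fun s hs => hsol.picard_neg_eq hs.1
    have hpicard := fun n => (measurable_iterate_picard (u := fun ω => -u ω) (x₀ := x₀)
      (fun ω z hz a b => (hu ω hz a b).neg) hmeas.neg n).comp
        (measurable_prodMk_left (x := (t : ℝ)))
    refine measurable_of_tendsto_metrizable
      (f := fun n => A.piecewise 0 fun ω => (ODE.picard (-u ω) 0 x₀)^[n] (fun _ => x₀) t)
      (fun n => measurable_const.piecewise hAm (hpicard n)) (tendsto_pi_nhds.2 fun ω => ?_)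
    by_cases hω : ω ∈ A
    · simp [hω]
    · simpa [hω] using hlim ω hω
  · filter_upwards [measure_eq_zero_iff_ae_notMem.1 hA0] with ω hω
    simp [hω]

end Picard

section VectorFields

variable {E : Type*} [NormedAddCommGroup E] [NormedSpace ℝ E]

theorem lipschitzWith_integral {S : Type*} [MeasurableSpace S] {π : Measure S}
    [IsProbabilityMeasure π] {g : E → S → E} {L : ℝ≥0} (hg : ∀ x, Integrable (g x) π)
    (hL : ∀ y, LipschitzWith L fun x => g x y) : LipschitzWith L fun x => ∫ y, g x y ∂π :=
  .of_dist_le_mul fun x x' => by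
    rw [dist_eq_norm, dist_eq_norm, ← integral_sub (hg x) (hg x')]
    exact norm_integral_le_of_bound fun y => (hL y).norm_sub_le x x'

variable [FiniteDimensional ℝ E]

theorem tendsto_of_forall_strongDual {κ : Type*} {l : Filter κ} {X : κ → E} {x : E}
    (h : ∀ φ : StrongDual ℝ E, Tendsto (fun k => φ (X k)) l (𝓝 (φ x))) : Tendsto X l (𝓝 x) := by
  let e := (Module.finBasis ℝ E).equivFunL
  exact e.toHomeomorph.isInducing.tendsto_nhds_iff.2 (tendsto_pi_nhds.2 fun i =>
    h ((ContinuousLinearMap.proj i).comp e.toContinuousLinearMap))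

variable {S : Type*} [TopologicalSpace S] [TopologicalSpace.PseudoMetrizableSpace S]
  [CompactSpace S] [MeasurableSpace S] [BorelSpace S] {g : E → S → E}

theorem integrableAlongCurves_comp_path (hg : Continuous fun p : E × S => g p.1 p.2) {v : ℝ → S}
    (hv : Measurable v) : IntegrableAlongCurves fun s x => g x (v s) := fun c hc a b => by
  borelize E
  have := FiniteDimensional.proper_real E
  obtain ⟨M, hM⟩ := (((isCompact_uIcc (a := a) (b := b)).image hc).prod
    (isCompact_univ (X := S))).exists_bound_of_continuousOn hg.continuousOn
  rw [intervalIntegrable_iff]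
  exact Measure.integrableOn_of_bounded (M := M) (by simp)
    (hg.measurable.comp (hc.measurable.prodMk hv)).aestronglyMeasurable
    ((ae_restrict_iff' measurableSet_uIoc).2 (Eventually.of_forall fun s hs =>
      hM (c s, v s) ⟨Set.mem_image_of_mem c (Set.uIoc_subset_uIcc hs), trivial⟩))

theorem IsFellerProcess.integrableAlongCurves {Ω : Type*} {mΩ : MeasurableSpace Ω}
    {𝓕 : Filtration ℝ≥0 mΩ} {V : ℝ≥0 → Ω → S} {P : Kernel S Ω} (hV : IsFellerProcess 𝓕 V P)
    (hg : Continuous fun p : E × S => g p.1 p.2) (ε : ℝ) (ω : Ω) :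
    IntegrableAlongCurves fun s x => g x (V (s / ε).toNNReal ω) := by
  simp only [div_eq_inv_mul]
  exact integrableAlongCurves_comp_path hg
    ((hV.measurable_rescaled ε⁻¹).comp measurable_prodMk_right)

end VectorFields

section StochasticGradient

variable {E : Type*} [NormedAddCommGroup E] [NormedSpace ℝ E] [FiniteDimensional ℝ E]
  {S : Type*} [TopologicalSpace S] [TopologicalSpace.MetrizableSpace S] [CompactSpace S]
  [MeasurableSpace S] [BorelSpace S] {Ω : Type*} {mΩ : MeasurableSpace Ω}
  {𝓕 : Filtration ℝ≥0 mΩ} {V : ℝ≥0 → Ω → S} {P : Kernel S Ω} {π : Measure S}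

theorem IsInvariantLaw.tendsto_rescaled_average_inMeasure (hV : IsFellerProcess 𝓕 V P)
    (hπ : IsInvariantLaw V P π) (huniq : ∀ μ : Measure S, IsInvariantLaw V P μ → μ = π)
    {G : S → E} (hG : Continuous G) {a b : ℝ} (ha : 0 ≤ a) (hab : a ≤ b) :
    Tendsto (fun p : ℝ × Ω => ∫ s in a..b, G (V (s / p.1).toNNReal p.2))
      (inMeasure (𝓝[>] 0) (π.bind P)) (𝓝 ((b - a) • ∫ y, G y ∂π)) := by
  have := hπ.1
  refine tendsto_of_forall_strongDual fun φ => ?_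
  have hφ := (hπ.tendsto_average_inMeasure hV huniq ⟨fun y => φ (G y), by fun_prop⟩ ha hab).comp
    (tendsto_map_id_inMeasure tendsto_inv_nhdsGT_zero)
  have hint : ∀ p : ℝ × Ω, φ (∫ s in a..b, G (V (s / p.1).toNNReal p.2)) =
      ∫ s in a..b, φ (G (V (s / p.1).toNNReal p.2)) := fun p =>
    (φ.intervalIntegral_comp_comm (hV.integrableAlongCurves (g := fun _ => G)
      (hG.comp continuous_snd) p.1 p.2 (continuous_const (y := 0)) a b)).symm
  simp only [hint]
  simp only [map_smul, smul_eq_mul, div_eq_inv_mul]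
  rwa [← φ.integral_comp_comm (hG.integrable_of_hasCompactSupport (.of_compactSpace G))]

theorem IsInvariantLaw.tendsto_inMeasure_of_solvesDescent (hV : IsFellerProcess 𝓕 V P)
    (hπ : IsInvariantLaw V P π) (huniq : ∀ μ : Measure S, IsInvariantLaw V P μ → μ = π)
    {g : E → S → E} (hg : Continuous fun p : E × S => g p.1 p.2) {L : ℝ≥0}
    (hL : ∀ y, LipschitzWith L fun x => g x y) {θ₀ : E} {θ : ℝ → Ω → C(ℝ≥0, E)}
    (hθ : ∀ ε > 0, ∀ᵐ ω ∂(π.bind P),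
      SolvesDescent (fun s x => g x (V (s / ε).toNNReal ω)) θ₀ (θ ε ω))
    {ζ : C(ℝ≥0, E)} (hζ : SolvesDescent (fun _ x => ∫ v, g x v ∂π) θ₀ ζ) :
    Tendsto (fun p : ℝ × Ω => θ p.1 p.2) (inMeasure (𝓝[>] 0) (π.bind P)) (𝓝 ζ) := by
  have := hπ.1
  have := FiniteDimensional.complete ℝ E
  have hslice : ∀ x, Continuous (g x) := fun x => hg.comp (Continuous.prodMk_right x)
  obtain ⟨M, hM⟩ := (isCompact_univ (X := S)).exists_bound_of_continuousOn (hslice 0).continuousOn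
  refine tendsto_of_solvesDescent (u := fun p s x => g x (V (s / p.1).toNNReal p.2))
    (fun p => hV.integrableAlongCurves hg p.1 p.2) (fun p s => hL _)
    (lipschitzWith_integral
      (fun x => (hslice x).integrable_of_hasCompactSupport (.of_compactSpace _)) hL)
    (fun p s => hM _ trivial)
    (fun x a b ha hab => hπ.tendsto_rescaled_average_inMeasure hV huniq (hslice x) ha hab)
    (eventually_inMeasure_of_ae ?_) hζ
  filter_upwards [self_mem_nhdsWithin] with ε hε using hθ ε hε

theorem IsFellerProcess.aestronglyMeasurable_comp_of_solvesDescent (hV : IsFellerProcess 𝓕 V P)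
    {ρ : Measure Ω} {g : E → S → E} (hg : Continuous fun p : E × S => g p.1 p.2) {L : ℝ≥0}
    (hL : ∀ y, LipschitzWith L fun x => g x y) {ε : ℝ} {θ₀ : E} {c : Ω → C(ℝ≥0, E)}
    (hc : ∀ᵐ ω ∂ρ, SolvesDescent (fun s x => g x (V (s / ε).toNNReal ω)) θ₀ (c ω))
    {F : C(ℝ≥0, E) → ℝ} (hF : Continuous F) : AEStronglyMeasurable (fun ω => F (c ω)) ρ := by
  borelize E
  borelize C(ℝ≥0, E)
  have hV_meas : Measurable fun p : ℝ × Ω => V (p.1 / ε).toNNReal p.2 := by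
    simpa only [div_eq_inv_mul] using hV.measurable_rescaled ε⁻¹
  have hc_meas : AEMeasurable c ρ := aemeasurable_of_solvesDescent
    (hV.integrableAlongCurves hg ε) (fun ω s => hL _)
    (hg.measurable.comp (measurable_snd.prodMk (hV_meas.comp measurable_fst))) hc
  exact (hF.measurable.comp_aemeasurable hc_meas).aestronglyMeasurable

end StochasticGradient

end SGP

theorem mainTheorem1_general {E : Type*} [NormedAddCommGroup E] [NormedSpace ℝ E]
    [FiniteDimensional ℝ E] {S : Type*} [TopologicalSpace S] [TopologicalSpace.MetrizableSpace S]
    [CompactSpace S] [MeasurableSpace S] [BorelSpace S] {Ω : Type*} {mΩ : MeasurableSpace Ω}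
    {𝓕 : Filtration ℝ≥0 mΩ} {V : ℝ≥0 → Ω → S} {P : Kernel S Ω} {π : Measure S}
    (hV : SGP.IsFellerProcess 𝓕 V P) (hπ : SGP.IsInvariantLaw V P π)
    (huniq : ∀ μ : Measure S, SGP.IsInvariantLaw V P μ → μ = π)
    {g : E → S → E} (hg : Continuous fun p : E × S => g p.1 p.2) {L : ℝ≥0}
    (hL : ∀ y, LipschitzWith L fun x => g x y) {θ₀ : E} {θ : ℝ → Ω → C(ℝ≥0, E)}
    (hθ : ∀ ε > 0, ∀ᵐ ω ∂(π.bind P),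
      SGP.SolvesDescent (fun s x => g x (V (s / ε).toNNReal ω)) θ₀ (θ ε ω))
    {ζ : C(ℝ≥0, E)} (hζ : SGP.SolvesDescent (fun _ x => ∫ v, g x v ∂π) θ₀ ζ)
    {F : C(ℝ≥0, E) → ℝ} (hF_bdd : ∃ M, ∀ φ, |F φ| ≤ M) (hF_cont : Continuous F) :
    (∀ ε > 0, Integrable (fun ω => F (θ ε ω)) (π.bind P)) ∧
      Tendsto (fun ε => ∫ ω, F (θ ε ω) ∂(π.bind P)) (𝓝[>] 0) (𝓝 (∫ _, F ζ ∂(π.bind P))) ∧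
      ∫ _, F ζ ∂(π.bind P) = F ζ := by
  have := hπ.isProbabilityMeasure_bind hV
  obtain ⟨M, hM⟩ := hF_bdd
  have hconst : ∫ _, F ζ ∂(π.bind P) = F ζ := by simp
  have hmeas : ∀ ε > 0, AEStronglyMeasurable (fun ω => F (θ ε ω)) (π.bind P) := fun ε hε =>
    hV.aestronglyMeasurable_comp_of_solvesDescent hg hL (hθ ε hε) hF_cont
  refine ⟨fun ε hε => .of_bound (hmeas ε hε) M (Eventually.of_forall fun ω => hM _), ?_, hconst⟩
  rw [hconst]
  exact SGP.tendsto_integral_of_tendsto_inMeasure (eventually_mem_nhdsWithin.mono hmeas)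
    (fun ε ω => hM _)
    ((hF_cont.tendsto ζ).comp (hπ.tendsto_inMeasure_of_solvesDescent hV huniq hg hL hθ hζ))

theorem mainTheorem1 {K : ℕ}
    {S : Type u} [MetricSpace S] [CompactSpace S] [MeasurableSpace S] [BorelSpace S]
    {Ω : Type v} {mΩ : MeasurableSpace Ω} (𝓕 : Filtration ℝ≥0 mΩ)
    (V : ℝ≥0 → Ω → S) (P : Kernel S Ω) (π : Measure S)
    (hV : SGP.IsFellerProcess 𝓕 V P) (hπ : SGP.IndexAssumption.{u, v, w} V P π)
    (f : EuclideanSpace ℝ (Fin K) → S → ℝ) (hf : SGP.TargetAssumption f π)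
    (θ₀ : EuclideanSpace ℝ (Fin K))
    (θ : ℝ → Ω → C(ℝ≥0, EuclideanSpace ℝ (Fin K)))
    (hθ : ∀ ε > 0, ∀ᵐ ω ∂(π.bind P), SGP.SolvesSGPC f ε θ₀ (fun t => V t ω) (θ ε ω))
    (ζ : C(ℝ≥0, EuclideanSpace ℝ (Fin K))) (hζ : SGP.SolvesFullFlow f π θ₀ ζ)
    (F : C(ℝ≥0, EuclideanSpace ℝ (Fin K)) → ℝ)
    (hF_bdd : ∃ M, ∀ φ, |F φ| ≤ M) (hF_cont : SGP.PathContinuous F) :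
    (∀ ε > 0, Integrable (fun ω => F (θ ε ω)) (π.bind P)) ∧
      Tendsto (fun ε => ∫ ω, F (θ ε ω) ∂(π.bind P)) (𝓝[>] 0) (𝓝 (∫ _, F ζ ∂(π.bind P))) ∧
      ∫ _, F ζ ∂(π.bind P) = F ζ := by
  obtain ⟨L, hL⟩ := hf.lipschitz
  exact mainTheorem1_general hV hπ.invariant hπ.unique hf.cont_grad hL hθ hζ hF_bdd
    hF_cont.continuous
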